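/- Let $\omega=e^{2\pi i/3}$, $\Lambda=\omega\mathbb Z\oplus\mathbb Z$ and $\Lambda^*=\frac{4\pi i}{\sqrt3}\Lambda$. Let $V\in C^\infty(\mathbb C)$ satisfy $V(z+\gamma)=V(z)$ for $\gamma\in\Lambda$ and $V(\omega z)=\bar\omega V(z)$. For $\alpha,k\in\mathbb C$ let $$Q(\alpha,k)=(2D_{\bar z}+k)^2-\alpha^2V(z):H^2(\mathbb C/\Lambda;\mathbb C)\to L^2(\mathbb C/\Lambda;\mathbb C),\qquad 2D_{\bar z}=\tfrac1i(\partial_{x_1}+i\partial_{x_2}),\quad z=x_1+ix_2 .$$ Define the multiplicity $m(\alpha,k)$ as follows. If $\ker Q(\alpha,k_0)=\{0\}$ for some $k_0\in\mathbb C$, then $$m(\alpha,k)=\frac1{2\pi i}\operatorname{tr}\oint_{\partial D}Q(\alpha,\zeta)^{-1}\,\partial_\zeta Q(\alpha,\zeta)\,d\zeta ,$$ where $\partial D$ is positively oriented and $D$ is an open disc containing $k$ such that $Q(\alpha,\zeta)$ is invertible for every $\zeta\in\overline D\setminus\{k\}$. If there is no such $k_0$, then $m(\alpha,k)=\infty$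 for all $k$. Then for all $\alpha\in\mathbb C$ and $k\in\Lambda^*$ the multiplicity $m(\alpha,k)$ is well defined (in the first case such discs $D$ exist and the value does not depend on the choice of $D$), and $m(\alpha,k)\ge 2$. -/

import Mathlib

open MeasureTheory Complex
open scoped ContDiff ComplexOrder

namespace ScalarModel

noncomputable section

/-- `ω = e^{2πi/3}`. -/
def om : ℂ := Complex.exp (2 * Real.pi * I / 3)

/-- The lattice `Λ = ωℤ ⊕ ℤ`. -/
def lattice : Set ℂ := {γ | ∃ a b : ℤ, γ = om * a + b}

/-- The dual lattice `Λ* = (4πi/√3) Λ`. -/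
def dualLattice : Set ℂ := {k | ∃ γ ∈ lattice, k = 4 * Real.pi * I / (Real.sqrt 3 : ℝ) * γ}

/-- Functions on `ℂ` that are periodic with respect to `Λ`. -/
def LatticePeriodic (f : ℂ → ℂ) : Prop := ∀ γ ∈ lattice, ∀ z, f (z + γ) = f z

/-- The potentials of the scalar model: `V ∈ C^∞(ℂ)`, `V(z + γ) = V(z)` for `γ ∈ Λ`, and
`V(ωz) = ω̄ V(z)`. -/
structure Potential where
  toFun : ℂ → ℂ
  smooth : ContDiff ℝ ∞ toFun
  periodic : LatticePeriodic toFun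
  rotation : ∀ z, toFun (om * z) = (starRingEnd ℂ) om * toFun z

/-! ### The torus `ℂ/Λ` and its `L²` space

The class of `sω + t` in `ℂ/Λ` is identified with the class of `(s, t)` in `ℝ²/ℤ²`; the measure is
the invariant probability measure. -/

/-- The torus `ℂ/Λ ≅ ℝ²/ℤ²`. -/
abbrev Torus : Type := UnitAddTorus (Fin 2)

/-- The invariant probability measure on the torus. -/
abbrev torusMeasure : Measure Torus := Measure.pi fun _ => AddCircle.haarAddCircle

/-- The representative `sω + t`, `s, t ∈ (0, 1]`, of a point of `ℂ/Λ`. -/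
def rep (x : Torus) : ℂ :=
  om * ((UnitAddTorus.measurableEquivPiIoc (0 : Fin 2 → ℝ) x).1 0 : ℝ) +
    ((UnitAddTorus.measurableEquivPiIoc (0 : Fin 2 → ℝ) x).1 1 : ℝ)

/-- `L²(ℂ/Λ; ℂ)`. -/
abbrev L2 : Type := Lp ℂ 2 torusMeasure

lemma measurable_rep : Measurable rep := by
  have h : Measurable fun x : Torus =>
      (UnitAddTorus.measurableEquivPiIoc (0 : Fin 2 → ℝ) x).1 :=
    measurable_subtype_coe.comp (UnitAddTorus.measurableEquivPiIoc (0 : Fin 2 → ℝ)).measurable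
  have h0 := (measurable_pi_apply (0 : Fin 2)).comp h
  have h1 := (measurable_pi_apply (1 : Fin 2)).comp h
  exact ((Complex.measurable_ofReal.comp h0).const_mul om).add (Complex.measurable_ofReal.comp h1)

lemma norm_rep_le (x : Torus) : ‖rep x‖ ≤ ‖om‖ + 1 := by
  have h := (UnitAddTorus.measurableEquivPiIoc (0 : Fin 2 → ℝ) x).2
  have key : ∀ i, ‖(((UnitAddTorus.measurableEquivPiIoc (0 : Fin 2 → ℝ) x).1 i : ℝ) : ℂ)‖ ≤ 1 := by
    intro i
    have hi := h i
    simp only [Pi.zero_apply, zero_add, Set.mem_Ioc] at hi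
    rw [Complex.norm_real, Real.norm_eq_abs, abs_of_pos hi.1]
    exact hi.2
  refine (norm_add_le _ _).trans (add_le_add ?_ (key 1))
  rw [norm_mul]
  exact mul_le_of_le_one_right (norm_nonneg _) (key 0)

/-- A continuous function on `ℂ`, read on the representatives, is bounded and measurable. -/
lemma memLp_comp_rep {g : ℂ → ℂ} (hg : Continuous g) :
    MemLp (fun x => g (rep x)) ⊤ torusMeasure := by
  obtain ⟨C, hC⟩ := (isCompact_closedBall (0 : ℂ) (‖om‖ + 1)).exists_bound_of_continuousOn
    hg.continuousOn
  exact memLp_top_of_bound (hg.measurable.comp measurable_rep).aestronglyMeasurable C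
    (Filter.Eventually.of_forall fun x => hC _ (by simpa using norm_rep_le x))

/-- Multiplication by (the function on the torus given by) a continuous periodic function. -/
def mulOp (g : ℂ → ℂ) (hg : Continuous g) : L2 →L[ℂ] L2 :=
  (ContinuousLinearMap.mul ℂ ℂ).holderL torusMeasure ⊤ 2 2 (memLp_comp_rep hg).toLp

/-! ### The Sobolev space `H²(ℂ/Λ)` -/

/-- `∂f/∂x₁`, where `z = x₁ + i x₂`. -/
def dx (f : ℂ → ℂ) (z : ℂ) : ℂ := fderiv ℝ f z 1

/-- `∂f/∂x₂`, where `z = x₁ + i x₂`. -/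
def dy (f : ℂ → ℂ) (z : ℂ) : ℂ := fderiv ℝ f z I

/-- Multi-indices `β ∈ ℕ²` with `|β| ≤ 2`. -/
abbrev MultiIndex : Type := {β : Fin 3 × Fin 3 // (β.1 : ℕ) + (β.2 : ℕ) ≤ 2}

/-- `∂^β f` for a smooth function `f`. -/
def partialD (β : MultiIndex) (f : ℂ → ℂ) : ℂ → ℂ := dx^[β.1.1] (dy^[β.1.2] f)

/-- `v = ∂^β u` weakly on `ℂ/Λ`: `∫ v φ = (-1)^{|β|} ∫ u ∂^β φ` for all smooth functions `φ` on
`ℂ/Λ`. -/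
def IsWeakDeriv (β : MultiIndex) (u v : L2) : Prop :=
  ∀ φ : ℂ → ℂ, ContDiff ℝ ∞ φ → LatticePeriodic φ →
    ∫ x, v x * φ (rep x) ∂torusMeasure =
      (-1) ^ ((β.1.1 : ℕ) + (β.1.2 : ℕ)) * ∫ x, u x * partialD β φ (rep x) ∂torusMeasure

lemma contDiff_partialD (β : MultiIndex) {f : ℂ → ℂ} (hf : ContDiff ℝ ∞ f) :
    ContDiff ℝ ∞ (partialD β f) := by
  have h1 : ∀ g : ℂ → ℂ, ContDiff ℝ ∞ g → ContDiff ℝ ∞ (dx g) := fun g hg =>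
    (hg.fderiv_right (m := ∞) (by simp)).clm_apply contDiff_const
  have h2 : ∀ g : ℂ → ℂ, ContDiff ℝ ∞ g → ContDiff ℝ ∞ (dy g) := fun g hg =>
    (hg.fderiv_right (m := ∞) (by simp)).clm_apply contDiff_const
  exact Function.Iterate.rec (fun g : ℂ → ℂ => ContDiff ℝ ∞ g)
    (Function.Iterate.rec (fun g : ℂ → ℂ => ContDiff ℝ ∞ g) hf h2 _) h1 _

lemma exists_pairing {g : ℂ → ℂ} (hg : Continuous g) :
    ∃ L : L2 →L[ℂ] ℂ, ∀ u : L2, L u = ∫ x, u x * g (rep x) ∂torusMeasure := by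
  have h2 : MemLp (fun x => g (rep x)) 2 torusMeasure := (memLp_comp_rep hg).mono_exponent le_top
  refine ⟨((ContinuousLinearMap.mul ℂ ℂ).lpPairing torusMeasure 2 2).flip h2.toLp, fun u => ?_⟩
  rw [ContinuousLinearMap.flip_apply, ContinuousLinearMap.lpPairing_eq_integral]
  refine integral_congr_ae ?_
  filter_upwards [h2.coeFn_toLp] with x hx
  simp [hx]

/-- The index of the function itself. -/
def idx0 : MultiIndex := ⟨(0, 0), by decide⟩

/-- The Sobolev space `H²(ℂ/Λ)`. An element is a function `u ∈ L²(ℂ/Λ)` that has weak derivatives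
`∂^β u ∈ L²(ℂ/Λ)` for all `|β| ≤ 2`, recorded as the (unique) family `(∂^β u)_{|β| ≤ 2}`. The norm
is `‖u‖² = ∑_{|β| ≤ 2} ‖∂^β u‖²`. -/
def H2 : Submodule ℂ (PiLp 2 fun _ : MultiIndex => L2) where
  carrier := {f | ∀ β, IsWeakDeriv β (f idx0) (f β)}
  add_mem' := by
    intro f g hf hg β φ hφ hper
    obtain ⟨L, hL⟩ := exists_pairing hφ.continuous
    obtain ⟨M, hM⟩ := exists_pairing (contDiff_partialD β hφ).continuous
    have h1 := hf β φ hφ hper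
    have h2 := hg β φ hφ hper
    rw [← hL, ← hM] at h1 h2 ⊢
    rw [PiLp.add_apply, PiLp.add_apply, map_add, map_add, h1, h2, mul_add]
  zero_mem' := by
    intro β φ hφ _
    obtain ⟨L, hL⟩ := exists_pairing hφ.continuous
    obtain ⟨M, hM⟩ := exists_pairing (contDiff_partialD β hφ).continuous
    rw [← hL, ← hM]
    simp
  smul_mem' := by
    intro c f hf β φ hφ hper
    obtain ⟨L, hL⟩ := exists_pairing hφ.continuous
    obtain ⟨M, hM⟩ := exists_pairing (contDiff_partialD β hφ).continuous
    have h1 := hf β φ hφ hper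
    rw [← hL, ← hM] at h1 ⊢
    rw [PiLp.smul_apply, PiLp.smul_apply, map_smul, map_smul, h1, smul_eq_mul, smul_eq_mul]
    ring

/-- `H²(ℂ/Λ)` is a Hilbert space. -/
instance : CompleteSpace H2 := by
  have hcl : IsClosed (H2 : Set (PiLp 2 fun _ : MultiIndex => L2)) := by
    have : (H2 : Set (PiLp 2 fun _ : MultiIndex => L2)) =
        ⋂ (β : MultiIndex) (φ : ℂ → ℂ) (_ : ContDiff ℝ ∞ φ) (_ : LatticePeriodic φ),
          {f | ∫ x, (f β) x * φ (rep x) ∂torusMeasure =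
            (-1) ^ ((β.1.1 : ℕ) + (β.1.2 : ℕ)) *
              ∫ x, (f idx0) x * partialD β φ (rep x) ∂torusMeasure} := by
      ext f
      simp only [Set.mem_iInter, Set.mem_ofPred_eq]
      rfl
    rw [this]
    refine isClosed_iInter fun β => isClosed_iInter fun φ => isClosed_iInter fun hφ =>
      isClosed_iInter fun _ => ?_
    obtain ⟨L, hL⟩ := exists_pairing hφ.continuous
    obtain ⟨M, hM⟩ := exists_pairing (contDiff_partialD β hφ).continuous
    simp only [← hL, ← hM]
    exact isClosed_eq (L.continuous.comp (PiLp.proj 2 (𝕜 := ℂ) (fun _ : MultiIndex => L2) β).continuous)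
      (continuous_const.mul
        (M.continuous.comp (PiLp.proj 2 (𝕜 := ℂ) (fun _ : MultiIndex => L2) idx0).continuous))
  exact hcl.completeSpace_coe

/-- The weak derivative `∂^β : H²(ℂ/Λ) → L²(ℂ/Λ)`. -/
def weakD (β : MultiIndex) : H2 →L[ℂ] L2 :=
  (PiLp.proj 2 (fun _ : MultiIndex => L2) β).comp H2.subtypeL

/-- The inclusion `H²(ℂ/Λ) → L²(ℂ/Λ)`. -/
def incl : H2 →L[ℂ] L2 := weakD idx0

/-- `2D_{z̄} = (1/i)(∂_{x₁} + i ∂_{x₂}) : H²(ℂ/Λ) → L²(ℂ/Λ)`. -/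
def twoDbar : H2 →L[ℂ] L2 :=
  (1 / I) • (weakD ⟨(1, 0), by decide⟩ + I • weakD ⟨(0, 1), by decide⟩)

/-- `(2D_{z̄})² = (1/i)² (∂_{x₁}² + 2i ∂_{x₁}∂_{x₂} + i² ∂_{x₂}²) : H²(ℂ/Λ) → L²(ℂ/Λ)`. -/
def twoDbarSq : H2 →L[ℂ] L2 :=
  (1 / I) ^ 2 • (weakD ⟨(2, 0), by decide⟩ + (2 * I) • weakD ⟨(1, 1), by decide⟩ +
    I ^ 2 • weakD ⟨(0, 2), by decide⟩)

/-- `Q(α, k) = (2D_{z̄} + k)² - α² V : H²(ℂ/Λ) → L²(ℂ/Λ)`, with the square expanded. -/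
def Q (V : Potential) (α k : ℂ) : H2 →L[ℂ] L2 :=
  (twoDbarSq + (2 * k) • twoDbar + k ^ 2 • incl) -
    α ^ 2 • (mulOp V.toFun V.smooth.continuous).comp incl

/-! ### Multiplicity -/

/-- The trace of a finite rank operator, that is, the trace of its restriction to its range. -/
def finiteRankTrace {E : Type*} [AddCommGroup E] [Module ℂ E] (T : E →ₗ[ℂ] E) : ℂ :=
  LinearMap.trace ℂ (LinearMap.range T) (T.rangeRestrict.comp (LinearMap.range T).subtype)

/-- The open disc with centre `c` and radius `r` contains `k`, and `k` is the only possible pole of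
`ζ ↦ Q(α, ζ)⁻¹` in the closed disc. -/
def IsIsolatingDisc (V : Potential) (α k c : ℂ) (r : ℝ) : Prop :=
  k ∈ Metric.ball c r ∧ ∀ ζ ∈ Metric.closedBall c r, ζ ≠ k → (Q V α ζ).IsInvertible

/-- `(1/2πi) tr ∮_{|ζ - c| = r} Q(α, ζ)⁻¹ ∂_ζ Q(α, ζ) dζ`, the integral being one of bounded operators
on `H²(ℂ/Λ)`. -/
def contourTrace (V : Potential) (α c : ℂ) (r : ℝ) : ℂ :=
  (1 / (2 * Real.pi * I)) * finiteRankTrace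
    (∮ ζ in C(c, r), (Q V α ζ).inverse.comp (deriv (fun ξ => Q V α ξ) ζ) : H2 →L[ℂ] H2).toLinearMap

open Classical in
/-- The multiplicity `m(α, k) ∈ ℂ ∪ {∞}`: if `ker Q(α, k₀) = {0}` for some `k₀`, then it is the
contour integral over the boundary of a disc that isolates `k`; otherwise it is `∞`. -/
def mult (V : Potential) (α k : ℂ) : WithTop ℂ :=
  if ∃ k₀ : ℂ, LinearMap.ker (Q V α k₀).toLinearMap = ⊥ then
    if h : ∃ D : ℂ × ℝ, IsIsolatingDisc V α k D.1 D.2 then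
      (contourTrace V α h.choose.1 h.choose.2 : ℂ)
    else 0
  else ⊤

end

end ScalarModel

/-! In the Fourier basis `2D_{z̄}` is diagonal, and its eigenvalues `freq n` are the points of `Λ*`,
each of them simple. Since `-π` is not among them, `T = (2D_{z̄} + π)⁻¹` is a compact operator on
`L²`, while `(2D_{z̄} + π)²` is an isomorphism from `H²` to `L²`. Factoring it out of `Q(α, ζ)`
leaves the quadratic pencil `A(ζ) = (1 - πT + ζT)² - α² V T²` on `L²`, with the same contour traces
(`Q_eq_torusPencil_comp`, `contourTrace_eq`). It is the identity plus a compact operator, so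
injectivity at one point gives invertibility there.

The multiplicity is a dimension. The pencil linearizes on `L² × L²` to `L(ζ) = L(ζ₀)(1 + (ζ - ζ₀)C)`
with `C` compact. The Riesz projection of `C` shows that the singular points are isolated and that
the trace of the residue of `L⁻¹L'` is the dimension of a generalized eigenspace
(`linearPencil_trace`). Cyclicity of the trace identifies it with the trace for `A⁻¹A'`
(`quadPencil_trace`). It remains to find two independent generalized null vectors.

They come from the threefold symmetry (`exists_jordan_chain`). For `k ∈ Λ*` the kernel of `2D_{z̄} +
k` is spanned by one exponential `b`. The rotation `R` of the frequencies about `-k` fixes `b`,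
multiplies the eigenvalues of `2D_{z̄} + k` by `ω²`, and satisfies `W R = ω R W` for `W = α² V`.
Hence `W (2D_{z̄} + k)⁻²`, with the inverse set to zero on `b`, commutes with `R` and acts on the
sectors `R = ω` and `R = ω²`, which have no component along `b`. There the Fredholm alternative
applies. As `W b` lies in the sector `ω²`, either `b` can be corrected to a null vector, or that
sector already contains one. The equation for the next vector of a Jordan chain has its right side
in the sector `ω`: either it is solvable, or that sector supplies a second, independent null vector.

If `Q(α, k₀)` is injective for no `k₀`, the multiplicity is `∞` and the bound is trivial. -/

namespace ScalarModel

noncomputable section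

/-! ### The trace of finite rank operators -/

section FiniteRankTrace

variable {E F : Type*} [AddCommGroup E] [Module ℂ E] [AddCommGroup F] [Module ℂ F]

/-- By `tr (AB) = tr (BA)`, applied to the inclusion of the range into `G` and to `T` restricted to
`G`, the choice of `G` is immaterial. Several operators can thus be traced on one common space,
which gives additivity. -/
lemma finiteRankTrace_eq_trace_restrict (T : E →ₗ[ℂ] E) (G : Submodule ℂ E)
    [FiniteDimensional ℂ G] (h : ∀ x, T x ∈ G) :
    finiteRankTrace T = LinearMap.trace ℂ G (T.codRestrict G h ∘ₗ G.subtype) := by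
  have hle : LinearMap.range T ≤ G := by
    rintro _ ⟨x, rfl⟩
    exact h x
  have : FiniteDimensional ℂ (LinearMap.range T) := Submodule.finiteDimensional_of_le hle
  have := LinearMap.trace_comp_comm' (R := ℂ) (T.rangeRestrict ∘ₗ G.subtype)
    (Submodule.inclusion hle)
  rw [finiteRankTrace]
  exact this.symm

lemma finiteRankTrace_comp_of_finiteDimensional [FiniteDimensional ℂ F] (g : E →ₗ[ℂ] F)
    (i : F →ₗ[ℂ] E) : finiteRankTrace (i ∘ₗ g) = LinearMap.trace ℂ F (g ∘ₗ i) := by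
  rw [finiteRankTrace_eq_trace_restrict (i ∘ₗ g) (LinearMap.range i) (fun x => ⟨g x, rfl⟩)]
  have := LinearMap.trace_comp_comm' (R := ℂ) (g ∘ₗ (LinearMap.range i).subtype) i.rangeRestrict
  exact this

/-- Cyclicity of the trace when one of the factors has finite rank. -/
lemma finiteRankTrace_comp_comm (T : E →ₗ[ℂ] F) (S : F →ₗ[ℂ] E)
    [FiniteDimensional ℂ (LinearMap.range T)] :
    finiteRankTrace (S ∘ₗ T) = finiteRankTrace (T ∘ₗ S) := by
  have h1 := finiteRankTrace_comp_of_finiteDimensional T.rangeRestrict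
    (S ∘ₗ (LinearMap.range T).subtype)
  have h2 := finiteRankTrace_comp_of_finiteDimensional (T.rangeRestrict ∘ₗ S)
    (LinearMap.range T).subtype
  exact h1.trans h2.symm

lemma finiteRankTrace_add (S T : E →ₗ[ℂ] E) [FiniteDimensional ℂ (LinearMap.range S)]
    [FiniteDimensional ℂ (LinearMap.range T)] :
    finiteRankTrace (S + T) = finiteRankTrace S + finiteRankTrace T := by
  set G := LinearMap.range S ⊔ LinearMap.range T
  have hS : ∀ x, S x ∈ G := fun x => Submodule.mem_sup_left ⟨x, rfl⟩
  have hT : ∀ x, T x ∈ G := fun x => Submodule.mem_sup_right ⟨x, rfl⟩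
  rw [finiteRankTrace_eq_trace_restrict S G hS, finiteRankTrace_eq_trace_restrict T G hT,
    finiteRankTrace_eq_trace_restrict (S + T) G (fun x => G.add_mem (hS x) (hT x)), ← map_add]
  rfl

lemma finiteDimensional_range_comp_left (T : E →ₗ[ℂ] F) {G : Type*} [AddCommGroup G] [Module ℂ G]
    (S : F →ₗ[ℂ] G) [FiniteDimensional ℂ (LinearMap.range T)] :
    FiniteDimensional ℂ (LinearMap.range (S ∘ₗ T)) := by
  rw [LinearMap.range_comp]
  infer_instance

lemma finiteDimensional_range_comp_right (T : E →ₗ[ℂ] F) {G : Type*} [AddCommGroup G] [Module ℂ G]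
    (S : G →ₗ[ℂ] E) [FiniteDimensional ℂ (LinearMap.range T)] :
    FiniteDimensional ℂ (LinearMap.range (T ∘ₗ S)) :=
  Submodule.finiteDimensional_of_le (LinearMap.range_comp_le_range S T)

end FiniteRankTrace

/-! ### Riesz theory of compact operators -/

section Riesz

variable {E : Type*} [NormedAddCommGroup E] [NormedSpace ℂ E]

/-- The Fredholm alternative for a compact perturbation of a nonzero multiple of the identity. -/
lemma isUnit_smul_one_add_of_injective [CompleteSpace E] {K : E →L[ℂ] E} (hK : IsCompactOperator K)
    {c : ℂ} (hc : c ≠ 0) (hinj : ∀ x, c • x + K x = 0 → x = 0) :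
    IsUnit (c • (1 : E →L[ℂ] E) + K) := by
  rcases hK.hasEigenvalue_or_mem_resolventSet (neg_ne_zero.mpr hc) with h | h
  · obtain ⟨x, hx⟩ := h.exists_hasEigenvector
    have h1 := hx.apply_eq_smul
    refine absurd (hinj x ?_) hx.2
    have h2 : K x = -c • x := h1
    rw [h2, neg_smul, add_neg_cancel]
  · rw [spectrum.mem_resolventSet_iff, ← IsUnit.neg_iff] at h
    convert h using 1
    ext x
    simp [Algebra.algebraMap_eq_smul_one, add_comm]

lemma isUnit_one_add_of_injective [CompleteSpace E] {K : E →L[ℂ] E} (hK : IsCompactOperator K)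
    (hinj : ∀ x, x + K x = 0 → x = 0) : IsUnit (1 + K) := by
  simpa using isUnit_smul_one_add_of_injective hK one_ne_zero (by simpa using hinj)

/-- Powers of `C - μ` are compact perturbations of multiples of the identity. -/
lemma isCompactOperator_sub_smul_pow {C : E →L[ℂ] E} (hC : IsCompactOperator C) (μ : ℂ) (n : ℕ) :
    IsCompactOperator ((C - μ • 1) ^ n - (-μ) ^ n • 1 : E →L[ℂ] E) := by
  induction n with
  | zero => simpa using! isCompactOperator_zero
  | succ n ih =>
    have h : ((C - μ • 1) ^ (n + 1) - (-μ) ^ (n + 1) • 1 : E →L[ℂ] E) =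
        ((C - μ • 1) ^ n - (-μ) ^ n • 1) * (C - μ • 1) + (-μ) ^ n • C := by
      ext x
      simp [pow_succ, sub_mul, mul_sub, mul_comm]
      module
    rw [h]
    exact (ih.comp_clm _).add (hC.smul _)

/-- The ascending chain of kernels of powers of `C - μ` is stationary. -/
lemma exists_ker_pow_eq {C : E →L[ℂ] E} (hC : IsCompactOperator C) {μ : ℂ} (hμ : μ ≠ 0) :
    ∃ n : ℕ, LinearMap.ker ((C - μ • 1) ^ (n + 1) : E →L[ℂ] E).toLinearMap ≤
      LinearMap.ker ((C - μ • 1) ^ n : E →L[ℂ] E).toLinearMap := by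
  by_contra! hne
  set S : E →L[ℂ] E := C - μ • 1 with hS
  have hmono : ∀ {m n : ℕ}, m ≤ n → ∀ x, (S ^ m) x = 0 → (S ^ n) x = 0 := by
    intro m n hmn x hx
    obtain ⟨d, rfl⟩ := Nat.exists_eq_add_of_le' hmn
    rw [pow_add, mul_apply_eq_comp, hx, map_zero]
  -- If the kernels grow strictly, Riesz's lemma (with constants `2 < 3`) gives bounded vectors `f
  -- n` in `ker S^(n+1)` at distance at least `1` from `ker S^n`. Their images under `C` stay `‖μ‖`
  -- apart, against compactness.
  have hex : ∀ n, ∃ x, (S ^ (n + 1)) x = 0 ∧ ‖x‖ ≤ 3 ∧ ∀ y, (S ^ n) y = 0 → 1 ≤ ‖x - y‖ := by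
    intro n
    obtain ⟨x, hx1, hx2⟩ := Set.not_subset.mp (hne n)
    set F : Submodule ℂ (LinearMap.ker (S ^ (n + 1) : E →L[ℂ] E).toLinearMap) :=
      LinearMap.ker ((S ^ n : E →L[ℂ] E).toLinearMap ∘ₗ Submodule.subtype _) with hF
    have hFc : IsClosed (F : Set (LinearMap.ker (S ^ (n + 1) : E →L[ℂ] E).toLinearMap)) :=
      isClosed_singleton.preimage ((S ^ n).continuous.comp continuous_subtype_val)
    obtain ⟨z, hz1, hz2⟩ := riesz_lemma_of_norm_lt (c := (2 : ℂ)) (R := 3) (by simp)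
      (by norm_num) hFc ⟨⟨x, hx1⟩, fun h => hx2 h⟩
    exact ⟨z, z.2, hz1, fun y hy => hz2 ⟨y, hmono n.le_succ y hy⟩ hy⟩
  choose f hf0 hfn hfd using hex
  have hfar : ∀ m n, m < n → ‖μ‖ ≤ ‖C (f n) - C (f m)‖ := by
    intro m n hmn
    have hCS : ∀ x, C x = S x + μ • x := fun x => by simp [hS]
    -- Chosen so that `C (f n) - C (f m) = μ (f n - u)`; it lies in `ker S^n` because `m < n`.
    set u : E := μ⁻¹ • (S (f m) + μ • f m - S (f n)) with hu
    have hu0 : (S ^ n) u = 0 := by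
      have h1 : (S ^ n) (S (f n)) = 0 := hf0 n
      have h2 : (S ^ n) (f m) = 0 := hmono hmn _ (hf0 m)
      have h3 : (S ^ n) (S (f m)) = 0 := by
        rw [← mul_apply_eq_comp, ← pow_succ, pow_succ', mul_apply_eq_comp,
          h2, map_zero]
      rw [hu, map_smul, map_sub, map_add, map_smul, h1, h2, h3]
      simp
    have h1 : C (f n) - C (f m) = μ • (f n - u) := by
      rw [hCS, hCS, smul_sub, hu, smul_inv_smul₀ hμ]
      abel
    rw [h1, norm_smul]
    exact le_mul_of_one_le_right (norm_nonneg _) (hfd n u hu0)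
  obtain ⟨K, hK, hK'⟩ := hC.image_closedBall_subset_compact 3
  obtain ⟨y, -, ψ, hψ, hψy⟩ := hK.tendsto_subseq (x := fun n => C (f n))
    (fun n => hK' ⟨f n, by simpa using hfn n, rfl⟩)
  have hcau := hψy.cauchySeq
  rw [Metric.cauchySeq_iff'] at hcau
  obtain ⟨N, hN⟩ := hcau ‖μ‖ (by positivity)
  have h1 := hN (N + 1) (Nat.le_succ N)
  rw [dist_eq_norm] at h1
  exact absurd h1 (not_lt.mpr (hfar _ _ (hψ (Nat.lt_succ_self N))))

/-- The kernels of all powers of `C - μ` are contained in that of a single one. -/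
lemma exists_forall_ker_pow_le {C : E →L[ℂ] E} (hC : IsCompactOperator C) {μ : ℂ} (hμ : μ ≠ 0) :
    ∃ n : ℕ, ∀ j x, ((C - μ • 1) ^ j : E →L[ℂ] E) x = 0 → ((C - μ • 1) ^ n : E →L[ℂ] E) x = 0 := by
  obtain ⟨n, hn⟩ := exists_ker_pow_eq hC hμ
  set S : E →L[ℂ] E := C - μ • 1
  refine ⟨n, fun j x hx => ?_⟩
  have key : ∀ d x, (S ^ (n + d)) x = 0 → (S ^ n) x = 0 := by
    intro d
    induction d with
    | zero => exact fun x hx => hx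
    | succ d ih =>
      intro x hx
      apply hn
      change (S ^ (n + 1)) x = 0
      rw [pow_succ, mul_apply_eq_comp] at *
      exact ih _ (by rw [← mul_apply_eq_comp, ← pow_succ]; exact hx)
  refine key j x ?_
  rw [pow_add, mul_apply_eq_comp, hx, map_zero]

/-- The compact operator `(C - μ)^n - (-μ)^n` is a nonzero multiple of the identity on this kernel,
and the identity is compact only in finite dimension. -/
lemma finiteDimensional_ker_sub_smul_pow {C : E →L[ℂ] E} (hC : IsCompactOperator C) {μ : ℂ}
    (hμ : μ ≠ 0) (n : ℕ) :
    FiniteDimensional ℂ (LinearMap.ker ((C - μ • 1) ^ n : E →L[ℂ] E).toLinearMap) := by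
  set N := LinearMap.ker ((C - μ • 1) ^ n : E →L[ℂ] E).toLinearMap
  have hK := isCompactOperator_sub_smul_pow hC μ n
  set K : E →L[ℂ] E := (C - μ • 1) ^ n - (-μ) ^ n • 1 with hKdef
  have hc : -(-μ) ^ n ≠ 0 := neg_ne_zero.mpr (pow_ne_zero _ (neg_ne_zero.mpr hμ))
  have hKN : ∀ x ∈ N, K x = -(-μ) ^ n • x := by
    intro x hx
    have hx' : ((C - μ • 1) ^ n : E →L[ℂ] E) x = 0 := hx
    rw [hKdef, sub_apply, hx']
    simp
  have hr := IsCompactOperator.restrict (f := K.toLinearMap) (V := N) hK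
    (fun x hx => by
      rw [ContinuousLinearMap.coe_coe, hKN x hx]
      exact N.smul_mem _ hx)
    (isClosed_singleton.preimage ((C - μ • 1) ^ n : E →L[ℂ] E).continuous)
  rw [← isCompactOperator_id_iff_finiteDimensional (𝕜 := ℂ), ← IsCompactOperator.smul_iff₀ hc]
  have heq : ⇑(K.toLinearMap.restrict (p := N) (q := N) fun x hx => by
      rw [ContinuousLinearMap.coe_coe, hKN x hx]
      exact N.smul_mem _ hx) = (-(-μ) ^ n) • (id : N → N) :=
    funext fun x => Subtype.ext (hKN x x.2)
  rw [heq] at hr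
  exact hr

/-- The Riesz decomposition of a Banach space associated with a compact operator `C` and `μ ≠ 0`,
given by the projection `P` onto the generalized eigenspace. -/
theorem exists_riesz_projection [CompleteSpace E] {C : E →L[ℂ] E} (hC : IsCompactOperator C)
    {μ : ℂ} (hμ : μ ≠ 0) :
    ∃ (n : ℕ) (P : E →L[ℂ] E), P * P = P ∧ P * C = C * P ∧ (C - μ • 1) ^ n * P = 0 ∧
      FiniteDimensional ℂ (LinearMap.range P.toLinearMap) ∧
      (∀ j x, ((C - μ • 1) ^ j : E →L[ℂ] E) x = 0 → P x = x) := by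
  obtain ⟨n, hn⟩ := exists_forall_ker_pow_le hC hμ
  have hfd := finiteDimensional_ker_sub_smul_pow hC hμ n
  have hcomm : ((C - μ • 1) ^ n : E →L[ℂ] E) * C = C * (C - μ • 1) ^ n := by
    have h1 : Commute (C - μ • (1 : E →L[ℂ] E)) C :=
      (Commute.refl C).sub_left ((Commute.one_left C).smul_left μ)
    exact (h1.pow_left n).eq
  have hK := isCompactOperator_sub_smul_pow hC μ n
  -- Stationarity of the kernels: the range and the kernel of `(C - μ)^n` meet only in zero.
  have hSS : ∀ x, ((C - μ • 1) ^ n : E →L[ℂ] E) (((C - μ • 1) ^ n : E →L[ℂ] E) x) = 0 →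
      ((C - μ • 1) ^ n : E →L[ℂ] E) x = 0 := by
    intro x hx
    rw [← mul_apply_eq_comp, ← pow_add] at hx
    exact hn _ x hx
  set S : E →L[ℂ] E := (C - μ • 1) ^ n with hS
  -- `P₀` is an arbitrary bounded projection onto `ker S` and need not commute with `C`. It makes `S
  -- + P₀` injective, hence invertible, and `P₀ (S + P₀)⁻¹` is then the projection onto `ker S`
  -- along the range of `S`.
  obtain ⟨p, hp⟩ := Submodule.ClosedComplemented.of_finiteDimensional (LinearMap.ker S.toLinearMap)
  set P₀ : E →L[ℂ] E := (Submodule.subtypeL _).comp p with hP₀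
  have hP₀S : ∀ x, S (P₀ x) = 0 := fun x => (p x).2
  have hP₀N : ∀ x, S x = 0 → P₀ x = x := fun x hx => congrArg Subtype.val (hp ⟨x, hx⟩)
  have hP₀c : IsCompactOperator P₀ :=
    have := FiniteDimensional.proper ℂ (LinearMap.ker S.toLinearMap)
    ((isCompactOperator_id (E := LinearMap.ker S.toLinearMap)).comp_clm p).clm_comp
      (LinearMap.ker S.toLinearMap).subtypeL
  have hU : IsUnit (S + P₀) := by
    have h1 := isUnit_smul_one_add_of_injective (hK.add hP₀c)
      (pow_ne_zero n (neg_ne_zero.mpr hμ)) (K := (S - (-μ) ^ n • 1) + P₀) ?_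
    · convert h1 using 1
      abel
    · intro x hx
      have hx' : S x + P₀ x = 0 := by
        rw [← hx]
        simp
        abel
      have h2 : S x = 0 := by
        apply hSS
        have := congrArg S hx'
        rwa [map_add, hP₀S, add_zero, map_zero] at this
      rw [h2, zero_add, hP₀N x h2] at hx'
      exact hx'
  obtain ⟨U, hU⟩ := hU
  have hUi : ∀ y, S ((U⁻¹ : (E →L[ℂ] E)ˣ).1 y) + P₀ ((U⁻¹ : (E →L[ℂ] E)ˣ).1 y) = y := by
    intro y
    have := congrArg (fun f : E →L[ℂ] E => f y) U.mul_inv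
    rw [hU] at this
    exact this
  set P : E →L[ℂ] E := P₀ * (U⁻¹ : (E →L[ℂ] E)ˣ).1 with hP
  have hSP : ∀ x, S (P x) = 0 := fun x => hP₀S _
  -- the decomposition `y = S x + n` with `S n = 0` determines `P y = n`
  have hchar : ∀ x m, S m = 0 → P (S x + m) = m := by
    intro x m hm
    have h1 := hUi (S x + m)
    set x' := (U⁻¹ : (E →L[ℂ] E)ˣ).1 (S x + m)
    have h2 : P (S x + m) = P₀ x' := rfl
    have h3 : S (x' - x) = m - P₀ x' := by
      rw [map_sub]
      linear_combination (norm := abel) h1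
    have h4 : S (x' - x) = 0 := by
      apply hSS
      rw [h3, map_sub, hm, hP₀S, sub_zero]
    rw [h2]
    rw [h4] at h3
    exact (sub_eq_zero.mp h3.symm).symm
  refine ⟨n, P, ?_, ?_, ?_, ?_, ?_⟩
  · ext y
    have := hchar 0 (P y) (hSP y)
    rwa [map_zero, zero_add] at this
  · ext y
    set x := (U⁻¹ : (E →L[ℂ] E)ˣ).1 y
    have hy : S x + P y = y := hUi y
    have hC' : ∀ x, S (C x) = C (S x) := fun x => congrArg (fun f : E →L[ℂ] E => f x) hcomm
    have h1 := hchar (C x) (C (P y)) (by rw [hC', hSP, map_zero])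
    rw [hC', ← map_add, hy] at h1
    exact h1
  · ext y
    exact hSP y
  · refine Submodule.finiteDimensional_of_le (S₂ := LinearMap.ker S.toLinearMap) ?_
    rintro _ ⟨x, rfl⟩
    exact hSP x
  · intro j x hx
    have := hchar 0 x (hn j x hx)
    rwa [map_zero, zero_add] at this

end Riesz

/-! ### Linear pencils: isolated singular points and the trace of the residue -/

section LinearPencil

open Filter Topology

lemma circleIntegral_clm_comp_comm {F G : Type*} [NormedAddCommGroup F] [NormedSpace ℂ F]
    [CompleteSpace F] [NormedAddCommGroup G] [NormedSpace ℂ G] [CompleteSpace G] (L : F →L[ℂ] G)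
    {f : ℂ → F} {c : ℂ} {r : ℝ} (hf : CircleIntegrable f c r) :
    (∮ z in C(c, r), L (f z)) = L (∮ z in C(c, r), f z) := by
  rw [circleIntegral, circleIntegral, ← L.intervalIntegral_comp_comm hf.out]
  simp

lemma commute_ringInverse_right {R : Type*} [Ring R] {a b : R} (h : Commute a b) :
    Commute a (Ring.inverse b) := by
  by_cases hb : IsUnit b
  · obtain ⟨u, rfl⟩ := hb
    rw [Ring.inverse_unit]
    exact h.units_inv_right
  · rw [Ring.inverse_non_unit _ hb]
    exact Commute.zero_right a

section CompressedTrace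

variable {E : Type*} [NormedAddCommGroup E] [NormedSpace ℂ E]

/-- The compression of an operator to a finite dimensional range, followed by the trace. -/
def compressedTrace (P : E →L[ℂ] E) [FiniteDimensional ℂ (LinearMap.range P.toLinearMap)] :
    (E →L[ℂ] E) →L[ℂ] ℂ :=
  (LinearMap.toContinuousLinearMap
    ((LinearMap.trace ℂ (LinearMap.range P.toLinearMap)) ∘ₗ
      (ContinuousLinearMap.coeLM ℂ :
        (LinearMap.range P.toLinearMap →L[ℂ] LinearMap.range P.toLinearMap) →ₗ[ℂ] _))).comp
    ((ContinuousLinearMap.compL ℂ _ E _ P.rangeRestrict).comp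
      ((ContinuousLinearMap.compL ℂ _ E E).flip (Submodule.subtypeL _)))

lemma compressedTrace_apply (P : E →L[ℂ] E)
    [FiniteDimensional ℂ (LinearMap.range P.toLinearMap)] (X : E →L[ℂ] E) :
    compressedTrace P X = LinearMap.trace ℂ (LinearMap.range P.toLinearMap)
      (P.toLinearMap.rangeRestrict ∘ₗ X.toLinearMap ∘ₗ (Submodule.subtype _)) := rfl

lemma compressedTrace_one (P : E →L[ℂ] E) [FiniteDimensional ℂ (LinearMap.range P.toLinearMap)]
    (hP : P * P = P) :
    compressedTrace P 1 = Module.finrank ℂ (LinearMap.range P.toLinearMap) := by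
  rw [compressedTrace_apply, ← LinearMap.trace_one]
  congr 1
  ext ⟨_, x, rfl⟩
  exact congrArg (fun f : E →L[ℂ] E => f x) hP

/-- `X` preserves the range of `P` and is nilpotent there, so its trace vanishes. -/
lemma compressedTrace_eq_zero (P : E →L[ℂ] E)
    [FiniteDimensional ℂ (LinearMap.range P.toLinearMap)] (hP : P * P = P) {X : E →L[ℂ] E}
    (hX : Commute P X) {n : ℕ} (hn : X ^ n * P = 0) : compressedTrace P X = 0 := by
  rw [compressedTrace_apply]
  refine (LinearMap.isNilpotent_trace_of_isNilpotent ⟨n, ?_⟩).eq_zero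
  have hPfix : ∀ y ∈ LinearMap.range P.toLinearMap, P y = y := by
    rintro _ ⟨x, rfl⟩
    exact congrArg (fun f : E →L[ℂ] E => f x) hP
  have hcomm : ∀ x, P (X x) = X (P x) := fun x => congrArg (fun f : E →L[ℂ] E => f x) hX.eq
  have key : ∀ m : ℕ, ∀ y : LinearMap.range P.toLinearMap,
      (((P.toLinearMap.rangeRestrict ∘ₗ X.toLinearMap ∘ₗ (Submodule.subtype _)) ^ m) y : E) =
        (X ^ m) y := by
    intro m
    induction m with
    | zero => exact fun y => rfl
    | succ m ih =>
      intro y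
      rw [pow_succ, Module.End.mul_apply, ih, pow_succ, mul_apply_eq_comp]
      congr 1
      change P (X y) = X y
      rw [hcomm, hPfix y y.2]
  ext y
  rw [key]
  have := congrArg (fun f : E →L[ℂ] E => f y) hn
  simp only [mul_apply_eq_comp, hPfix y y.2] at this
  exact this

lemma finiteRankTrace_eq_compressedTrace (P : E →L[ℂ] E)
    [FiniteDimensional ℂ (LinearMap.range P.toLinearMap)] {Z : E →L[ℂ] E} (hZ : P * Z = Z) :
    FiniteDimensional ℂ (LinearMap.range Z.toLinearMap) ∧
      finiteRankTrace Z.toLinearMap = compressedTrace P Z := by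
  have h : ∀ x, Z.toLinearMap x ∈ LinearMap.range P.toLinearMap := fun x =>
    ⟨Z x, congrArg (fun f : E →L[ℂ] E => f x) hZ⟩
  refine ⟨Submodule.finiteDimensional_of_le (S₂ := LinearMap.range P.toLinearMap) ?_, ?_⟩
  · rintro _ ⟨x, rfl⟩
    exact h x
  · rw [finiteRankTrace_eq_trace_restrict _ _ h, compressedTrace_apply]
    congr 1
    ext x
    exact (congrArg (fun f : E →L[ℂ] E => f x) hZ).symm

end CompressedTrace

variable {E : Type*} [NormedAddCommGroup E] [NormedSpace ℂ E] [CompleteSpace E]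
variable {C P : E →L[ℂ] E} {t : ℂ}

/-- Off the generalized eigenspace, `1 + t C` is injective where it should be. -/
lemma isUnit_one_add_smul_mul_one_sub (hC : IsCompactOperator C) (hP : P * P = P)
    (hPC : P * C = C * P) (hinj : ∀ x, P x = 0 → x + t • C x = 0 → x = 0) :
    IsUnit (1 + t • (C * (1 - P))) := by
  have hP' : ∀ x, P (P x) = P x := fun x => congrArg (fun f : E →L[ℂ] E => f x) hP
  have hPC' : ∀ x, P (C x) = C (P x) := fun x => congrArg (fun f : E →L[ℂ] E => f x) hPC
  refine isUnit_one_add_of_injective ((hC.comp_clm (1 - P)).smul t) fun x hx => ?_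
  have hx' : x + t • C (x - P x) = 0 := hx
  have hPx : P x = 0 := by
    have := congrArg P hx'
    simpa [hPC', hP'] using this
  rw [hPx, sub_zero] at hx'
  exact hinj x hPx hx'

/-- The linear pencil `s ↦ 1 + (s - s₀) C` with `C` compact: points where it is not invertible are
isolated, and the trace of the residue of its logarithmic derivative is the dimension of the
generalized eigenspace. -/
theorem linearPencil_trace (hC : IsCompactOperator C) {s₀ w : ℂ} (hw : w ≠ s₀) :
    ∃ N : Submodule ℂ E, FiniteDimensional ℂ N ∧
      (∀ (j : ℕ) (x : E), ((1 + (w - s₀) • C) ^ j : E →L[ℂ] E) x = 0 → x ∈ N) ∧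
      (∀ᶠ s in 𝓝[≠] w, IsUnit (1 + (s - s₀) • C)) ∧
      ∀ (c : ℂ) (r : ℝ), w ∈ Metric.ball c r →
        (∀ s ∈ Metric.closedBall c r, s ≠ w → IsUnit (1 + (s - s₀) • C)) →
        (∀ g : ℂ → ℂ, Differentiable ℂ g → FiniteDimensional ℂ (LinearMap.range
          (∮ s in C(c, r), g s • (Ring.inverse (1 + (s - s₀) • C) * C) : E →L[ℂ] E).toLinearMap)) ∧
        finiteRankTrace (∮ s in C(c, r), Ring.inverse (1 + (s - s₀) • C) * C : E →L[ℂ] E).toLinearMap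
          = 2 * Real.pi * I * Module.finrank ℂ N := by
  have hw' : w - s₀ ≠ 0 := sub_ne_zero.mpr hw
  set μ : ℂ := -(w - s₀)⁻¹ with hμdef
  have hμ : μ ≠ 0 := neg_ne_zero.mpr (inv_ne_zero hw')
  obtain ⟨n, P, hP, hPC, hPn, hfd, hPj⟩ := exists_riesz_projection hC hμ
  have hP' : ∀ x, P (P x) = P x := fun x => congrArg (fun f : E →L[ℂ] E => f x) hP
  have hPC' : ∀ x, P (C x) = C (P x) := fun x => congrArg (fun f : E →L[ℂ] E => f x) hPC
  have hfactor : (1 + (w - s₀) • C : E →L[ℂ] E) = (w - s₀) • (C - μ • 1) := by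
    rw [smul_sub, smul_smul, hμdef, mul_neg, mul_inv_cancel₀ hw', neg_smul, one_smul,
      sub_neg_eq_add, add_comm]
  have hinjw : ∀ x, P x = 0 → x + (w - s₀) • C x = 0 → x = 0 := by
    intro x hPx hx
    rw [← hPx]
    refine (hPj 1 x ?_).symm
    have h1 : (1 + (w - s₀) • C : E →L[ℂ] E) x = 0 := hx
    rw [hfactor, smul_apply, smul_eq_zero] at h1
    simpa using h1.resolve_left hw'
  have hunitw : IsUnit (1 + (w - s₀) • (C * (1 - P))) :=
    isUnit_one_add_smul_mul_one_sub hC hP hPC hinjw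
  refine ⟨LinearMap.range P.toLinearMap, hfd, ?_, ?_, ?_⟩
  · intro j x hx
    refine ⟨x, hPj j x ?_⟩
    rw [hfactor, smul_pow, smul_apply, smul_eq_zero] at hx
    exact hx.resolve_left (pow_ne_zero _ hw')
  · have hcont : Continuous fun s : ℂ => (1 + (s - s₀) • (C * (1 - P)) : E →L[ℂ] E) := by fun_prop
    have h1 : ∀ᶠ s in 𝓝 w, IsUnit (1 + (s - s₀) • (C * (1 - P))) :=
      hcont.continuousAt.eventually (Units.isOpen.mem_nhds hunitw)
    filter_upwards [nhdsWithin_le_nhds h1, self_mem_nhdsWithin] with s hs hsw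
    -- A null vector `x` has no part off the range of `P`, where the pencil is still invertible near
    -- `w`. Its part in that range would be an eigenvector of `C` for `-(s - s₀)⁻¹ ≠ μ`, while `C -
    -- μ` is nilpotent there.
    refine isUnit_one_add_of_injective (hC.smul (s - s₀)) fun x hx => ?_
    have hx' : x + (s - s₀) • C x = 0 := hx
    have hPx : P x + (s - s₀) • C (P x) = 0 := by
      have := congrArg P hx'
      simpa [hPC'] using this
    have hQx : x - P x = 0 := by
      have hinj := (ContinuousLinearMap.isUnit_iff_bijective.mp hs).1
      apply hinj
      rw [map_zero]
      have : (x - P x) + (s - s₀) • C (x - P x) = 0 := by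
        rw [map_sub, smul_sub]
        linear_combination (norm := abel) hx' - hPx
      simpa [hP'] using this
    rw [sub_eq_zero] at hQx
    rw [hQx]
    have hs0 : (C - μ • 1 : E →L[ℂ] E) (P x) = (-(s - s₀)⁻¹ - μ) • P x ∨ s - s₀ = 0 := by
      by_cases h0 : s - s₀ = 0
      · exact Or.inr h0
      · left
        have : C (P x) = -(s - s₀)⁻¹ • P x := by
          rw [neg_smul, eq_neg_iff_add_eq_zero, ← smul_right_injective E h0 |>.eq_iff]
          simp only [smul_add, smul_zero, smul_inv_smul₀ h0]
          rw [add_comm]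
          exact hPx
        simp [this, sub_smul]
    rcases hs0 with hs0 | hs0
    · have hpow : ∀ m : ℕ, ((C - μ • 1) ^ m : E →L[ℂ] E) (P x) = (-(s - s₀)⁻¹ - μ) ^ m • P x := by
        intro m
        induction m with
        | zero => simp
        | succ m ih => rw [pow_succ, mul_apply_eq_comp, hs0, map_smul, ih, smul_smul, pow_succ']
      have h2 : ((C - μ • 1) ^ n : E →L[ℂ] E) (P x) = 0 :=
        congrArg (fun f : E →L[ℂ] E => f x) hPn
      rw [hpow, smul_eq_zero] at h2
      refine h2.resolve_left (pow_ne_zero _ ?_)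
      rw [hμdef, sub_neg_eq_add, neg_add_eq_sub, sub_ne_zero]
      intro h
      exact hsw (sub_left_injective (inv_injective h.symm))
    · simpa [hs0] using hPx
  · intro c r hwb hunit
    have hr : 0 ≤ r := (Metric.pos_of_mem_ball hwb).le
    have hsw : ∀ s ∈ Metric.sphere c r, s ≠ w := by
      rintro s hs rfl
      exact (Metric.mem_ball.mp hwb).ne hs
    have hunit' : ∀ s ∈ Metric.sphere c r, IsUnit (1 + (s - s₀) • C) := fun s hs =>
      hunit s (Metric.sphere_subset_closedBall hs) (hsw s hs)
    set B : ℂ → (E →L[ℂ] E) := fun s => Ring.inverse (1 + (s - s₀) • C) * C with hB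
    have hPfam : ∀ s : ℂ, Commute P (1 + (s - s₀) • C) := fun s =>
      (Commute.one_right P).add_right ((show Commute P C from hPC).smul_right _)
    have hPinv : ∀ s : ℂ, Commute P (Ring.inverse (1 + (s - s₀) • C)) := fun s =>
      commute_ringInverse_right (hPfam s)
    have hPB : ∀ s : ℂ, Commute P (B s) := fun s => (hPinv s).mul_right hPC
    have hBcont : ContinuousOn B (Metric.sphere c r) := by
      intro s hs
      refine ContinuousAt.continuousWithinAt ?_
      have h1 : DifferentiableAt ℂ (fun s : ℂ => Ring.inverse (1 + (s - s₀) • C)) s :=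
        DifferentiableAt.inverse (by fun_prop) (hunit' s hs)
      exact (h1.mul_const C).continuousAt
    have hBint : CircleIntegrable B c r := hBcont.circleIntegrable hr
    -- the part off the generalized eigenspace is holomorphic
    have hoff : ∀ g : ℂ → ℂ, Differentiable ℂ g →
        (∮ s in C(c, r), (g s • B s) * (1 - P)) = 0 := by
      intro g hg
      have hu : ∀ s ∈ Metric.closedBall c r, IsUnit (1 + (s - s₀) • (C * (1 - P))) := by
        intro s hs
        by_cases h : s = w
        · rw [h]
          exact hunitw
        · refine isUnit_one_add_smul_mul_one_sub hC hP hPC fun x _ hx => ?_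
          apply (ContinuousLinearMap.isUnit_iff_bijective.mp (hunit s hs h)).1
          rw [map_zero]
          exact hx
      have hd : ∀ s ∈ Metric.closedBall c r, DifferentiableAt ℂ
          (fun s => g s • (Ring.inverse (1 + (s - s₀) • (C * (1 - P))) * (C * (1 - P)))) s := by
        intro s hs
        have h1 : DifferentiableAt ℂ
            (fun s : ℂ => Ring.inverse (1 + (s - s₀) • (C * (1 - P)))) s :=
          DifferentiableAt.inverse (by fun_prop) (hu s hs)
        exact (hg s).smul (h1.mul_const _)
      rw [← Complex.circleIntegral_eq_zero_of_differentiable_on_off_countable hr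
        Set.countable_empty (fun s hs => (hd s hs).continuousAt.continuousWithinAt)
        (fun s hs => hd s (Metric.ball_subset_closedBall hs.1))]
      refine circleIntegral.integral_congr hr fun s hs => ?_
      have hcs := Metric.sphere_subset_closedBall hs
      set D : E →L[ℂ] E := C * (1 - P) with hD
      have hDD : C * D = D * D := by
        have h2 : (1 - P) * C = C * (1 - P) := by rw [sub_mul, mul_sub, hPC, one_mul, mul_one]
        have h3 : (1 - P) * (1 - P) = 1 - P := by
          rw [mul_sub, sub_mul, sub_mul, hP]
          simp
        rw [hD, mul_assoc, ← mul_assoc (1 - P) C, h2, mul_assoc C, h3]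
      -- This intertwining turns `(1 + (s - s₀)C)⁻¹ D` into `D (1 + (s - s₀)D)⁻¹`, which is defined
      -- at `w` as well and is holomorphic on the whole disc.
      have hX : (1 + (s - s₀) • C) * D = D * (1 + (s - s₀) • D) := by
        rw [add_mul, mul_add, smul_mul_assoc, mul_smul_comm, hDD, one_mul, mul_one]
      have hX2 : Commute D (1 + (s - s₀) • D) :=
        (Commute.one_right D).add_right ((Commute.refl D).smul_right _)
      change (g s • (Ring.inverse (1 + (s - s₀) • C) * C)) * (1 - P) =
        g s • (Ring.inverse (1 + (s - s₀) • D) * D)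
      rw [smul_mul_assoc]
      congr 1
      rw [mul_assoc, ← hD, ← (commute_ringInverse_right hX2).eq]
      calc Ring.inverse (1 + (s - s₀) • C) * D
          = Ring.inverse (1 + (s - s₀) • C) *
              (D * (1 + (s - s₀) • D) * Ring.inverse (1 + (s - s₀) • D)) := by
            rw [mul_assoc D, Ring.mul_inverse_cancel _ (hu s hcs), mul_one]
        _ = D * Ring.inverse (1 + (s - s₀) • D) := by
            rw [← hX, mul_assoc, ← mul_assoc, Ring.inverse_mul_cancel _ (hunit' s hs), one_mul]
    -- Only the part on the range of `P` survives integration, whence finite rank. The weight `g` is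
    -- carried along because the quadratic pencil needs the moment with `g s = s` too.
    have hZ : ∀ g : ℂ → ℂ, Differentiable ℂ g →
        P * (∮ s in C(c, r), g s • B s) = ∮ s in C(c, r), g s • B s := by
      intro g hg
      have hgint : CircleIntegrable (fun s => g s • B s) c r :=
        (hg.continuous.continuousOn.smul hBcont).circleIntegrable hr
      have hcirc : ∀ X : E →L[ℂ] E,
          (∮ s in C(c, r), (g s • B s) * X) = (∮ s in C(c, r), g s • B s) * X :=
        fun X => circleIntegral_clm_comp_comm
          ((ContinuousLinearMap.mul ℂ (E →L[ℂ] E)).flip X) hgint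
      have hcircl : ∀ X : E →L[ℂ] E,
          (∮ s in C(c, r), X * (g s • B s)) = X * (∮ s in C(c, r), g s • B s) :=
        fun X => circleIntegral_clm_comp_comm (ContinuousLinearMap.mul ℂ (E →L[ℂ] E) X) hgint
      have h0 := hoff g hg
      rw [hcirc, mul_sub, mul_one, sub_eq_zero, ← hcirc] at h0
      rw [← hcircl, h0]
      simp only [((hPB _).smul_right _).eq]
    refine ⟨fun g hg => (finiteRankTrace_eq_compressedTrace P (hZ g hg)).1, ?_⟩
    have hZ1 := hZ (fun _ => 1) (differentiable_const 1)
    simp only [one_smul] at hZ1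
    rw [(finiteRankTrace_eq_compressedTrace P hZ1).2]
    rw [← circleIntegral_clm_comp_comm _ hBint]
    have hval : ∀ s ∈ Metric.sphere c r, compressedTrace P (B s) =
        Module.finrank ℂ (LinearMap.range P.toLinearMap) * (s - w)⁻¹ := by
      intro s hs
      have hne : s - w ≠ 0 := sub_ne_zero.mpr (hsw s hs)
      have hinvcomm : Commute (Ring.inverse (1 + (s - s₀) • C)) (C - μ • 1) := by
        have h1 : Commute (C - μ • 1) (1 + (s - s₀) • C) :=
          ((Commute.one_right _).add_right ((Commute.refl C).smul_right _)).sub_left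
            ((Commute.one_left _).smul_left _)
        exact (commute_ringInverse_right h1).symm
      -- The difference has the factor `C - μ`, nilpotent on the range of `P`. Its compressed trace
      -- is therefore zero, and that of `B s` is the dimension times `(s - w)⁻¹`.
      have hdiff : B s - (s - w)⁻¹ • 1 =
          (-(w - s₀) * (s - w)⁻¹) • (Ring.inverse (1 + (s - s₀) • C) * (C - μ • 1)) := by
        have h1 : ((s - w)⁻¹ • 1 : E →L[ℂ] E) =
            Ring.inverse (1 + (s - s₀) • C) * ((s - w)⁻¹ • (1 + (s - s₀) • C)) := by
          rw [mul_smul_comm, Ring.inverse_mul_cancel _ (hunit' s hs)]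
        rw [h1, hB]
        simp only
        rw [← mul_sub, ← mul_smul_comm]
        congr 1
        rw [hμdef]
        have e1 : (s - w)⁻¹ * (s - s₀) = 1 + (s - w)⁻¹ * (w - s₀) := by
          field_simp
          ring
        have e2 : (-(w - s₀) * (s - w)⁻¹) * -(w - s₀)⁻¹ = (s - w)⁻¹ := by
          field_simp
        rw [smul_add, smul_smul, e1, smul_sub, smul_smul, e2]
        module
      have hzero : compressedTrace P (B s - (s - w)⁻¹ • 1) = 0 := by
        rw [hdiff, map_smul, smul_eq_zero]
        right
        refine compressedTrace_eq_zero P hP (n := n) ?_ ?_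
        · refine (hPinv s).mul_right ?_
          exact (show Commute P C from hPC).sub_right ((Commute.one_right P).smul_right _)
        · rw [hinvcomm.mul_pow, mul_assoc, hPn, mul_zero]
      rw [map_sub, sub_eq_zero, map_smul, compressedTrace_one P hP] at hzero
      rw [hzero, smul_eq_mul, mul_comm]
    rw [circleIntegral.integral_congr hr hval, circleIntegral.integral_const_mul,
      circleIntegral.integral_sub_inv_of_mem_ball hwb, mul_comm]

end LinearPencil

/-! ### Quadratic pencils and their linearization -/

section QuadraticPencil

open Filter Topology

variable {E : Type*} [NormedAddCommGroup E] [NormedSpace ℂ E]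

/-- The quadratic operator pencil `ζ ↦ (H + ζ T)² - K`. -/
def quadPencil (H T K : E →L[ℂ] E) (ζ : ℂ) : E →L[ℂ] E := (H + ζ • T) * (H + ζ • T) - K

/-- The linearization of the quadratic pencil `ζ ↦ (H + ζ T)² - K`. -/
def linearization (H T K : E →L[ℂ] E) (ζ : ℂ) : E × E →L[ℂ] E × E :=
  (H.comp (.fst ℂ E E) - .snd ℂ E E).prod (H.comp (.snd ℂ E E) - K.comp (.fst ℂ E E)) +
    ζ • T.prodMap T

variable {H T K : E →L[ℂ] E} {ζ : ℂ}

lemma quadPencil_apply (u : E) :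
    quadPencil H T K ζ u = (H + ζ • T) ((H + ζ • T) u) - K u := rfl

lemma linearization_apply (u v : E) : linearization H T K ζ (u, v) =
    ((H + ζ • T) u - v, (H + ζ • T) v - K u) := by
  change (H u - v + ζ • T u, H v - K u + ζ • T v) = (H u + ζ • T u - v, H v + ζ • T v - K u)
  rw [sub_add_eq_add_sub, sub_add_eq_add_sub]

lemma linearization_sub (ζ ζ₀ : ℂ) : linearization H T K ζ =
    linearization H T K ζ₀ + (ζ - ζ₀) • (T.prodMap T : E × E →L[ℂ] E × E) := by
  have h : ζ • (T.prodMap T : E × E →L[ℂ] E × E) = ζ₀ • T.prodMap T + (ζ - ζ₀) • T.prodMap T := by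
    rw [← add_smul, add_sub_cancel]
  rw [linearization, linearization, h, add_assoc]

variable [CompleteSpace E]

/-- Eliminating `v = (H + ζT)u - f` from the block system with right side `(f, g)` leaves the
equation of the quadratic pencil for `u`, with right side `g + (H + ζT)f`. -/
lemma isUnit_linearization_iff :
    IsUnit (linearization H T K ζ) ↔ IsUnit (quadPencil H T K ζ) := by
  rw [ContinuousLinearMap.isUnit_iff_bijective, ContinuousLinearMap.isUnit_iff_bijective]
  constructor
  · rintro ⟨hi, hs⟩
    constructor
    · rw [injective_iff_map_eq_zero] at hi ⊢
      intro u hu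
      have := hi (u, (H + ζ • T) u) (by
        rw [linearization_apply, sub_self]
        exact Prod.ext rfl hu)
      exact congrArg Prod.fst this
    · intro g
      obtain ⟨⟨u, v⟩, h⟩ := hs (0, g)
      rw [linearization_apply, Prod.mk.injEq, sub_eq_zero] at h
      refine ⟨u, ?_⟩
      rw [quadPencil_apply, h.1, h.2]
  · rintro ⟨hi, hs⟩
    constructor
    · rw [injective_iff_map_eq_zero] at hi ⊢
      rintro ⟨u, v⟩ h
      rw [linearization_apply] at h
      obtain ⟨h1, h2⟩ := Prod.mk.inj h
      rw [sub_eq_zero] at h1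
      have hu : u = 0 := hi u (by rw [quadPencil_apply, h1, h2])
      rw [← h1, hu, map_zero, Prod.mk_zero_zero]
    · rintro ⟨f, g⟩
      obtain ⟨u, hu⟩ := hs (g + (H + ζ • T) f)
      refine ⟨(u, (H + ζ • T) u - f), ?_⟩
      rw [quadPencil_apply] at hu
      rw [linearization_apply, map_sub]
      refine Prod.ext (by simp) ?_
      simp only
      rw [sub_right_comm, hu, add_sub_cancel_right]

lemma ringInverse_linearization_apply (h : IsUnit (quadPencil H T K ζ)) (f g : E) :
    Ring.inverse (linearization H T K ζ) (f, g) =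
      (Ring.inverse (quadPencil H T K ζ) (g + (H + ζ • T) f),
        (H + ζ • T) (Ring.inverse (quadPencil H T K ζ) (g + (H + ζ • T) f)) - f) := by
  have hL := isUnit_linearization_iff.mpr h
  apply (ContinuousLinearMap.isUnit_iff_bijective.mp hL).1
  rw [← mul_apply_eq_comp, Ring.mul_inverse_cancel _ hL, linearization_apply, map_sub]
  have hA : ∀ y, quadPencil H T K ζ (Ring.inverse (quadPencil H T K ζ) y) = y := fun y => by
    rw [← mul_apply_eq_comp, Ring.mul_inverse_cancel _ h]
    rfl
  have := hA (g + (H + ζ • T) f)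
  rw [quadPencil_apply] at this
  refine Prod.ext (by simp) ?_
  simp only
  rw [sub_right_comm, this, add_sub_cancel_right]
  rfl

/-- Multiplicities of a quadratic pencil `(H + ζ T)² - K` with `T` compact: if the point `w` carries
a Jordan chain of length two or two independent null vectors, then the trace of the residue of the
logarithmic derivative is an integer `≥ 2`. -/
theorem quadPencil_trace (hHT : Commute H T) (hT : IsCompactOperator T) {ζ₀ w : ℂ}
    (h₀ : IsUnit (quadPencil H T K ζ₀)) {f₀ f₁ : E} (hf₀ : f₀ ≠ 0)
    (hker : quadPencil H T K w f₀ = 0)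
    (hf₁ : quadPencil H T K w f₁ = -(2 : ℂ) • (H + w • T) (T f₀) ∨
      (quadPencil H T K w f₁ = 0 ∧ ∀ c : ℂ, c • f₀ ≠ f₁)) :
    ∃ m : ℕ, 2 ≤ m ∧ (∀ᶠ ζ in 𝓝[≠] w, IsUnit (quadPencil H T K ζ)) ∧
      ∀ (c : ℂ) (r : ℝ), w ∈ Metric.ball c r →
        (∀ ζ ∈ Metric.closedBall c r, ζ ≠ w → IsUnit (quadPencil H T K ζ)) →
        FiniteDimensional ℂ (LinearMap.range (∮ ζ in C(c, r), Ring.inverse (quadPencil H T K ζ) *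
          ((2 : ℂ) • (T * (H + ζ • T))) : E →L[ℂ] E).toLinearMap) ∧
        finiteRankTrace (∮ ζ in C(c, r), Ring.inverse (quadPencil H T K ζ) *
          ((2 : ℂ) • (T * (H + ζ • T))) : E →L[ℂ] E).toLinearMap = 2 * Real.pi * I * m := by
  have hL₀ := isUnit_linearization_iff.mpr h₀
  have hw : w ≠ ζ₀ := by
    rintro rfl
    exact hf₀ ((ContinuousLinearMap.isUnit_iff_bijective.mp h₀).1 (by rw [hker, map_zero]))
  set S : E × E →L[ℂ] E × E := T.prodMap T with hS
  have hSc : IsCompactOperator S := by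
    have h1 : IsCompactOperator ((ContinuousLinearMap.inl ℂ E E) ∘ T ∘ (ContinuousLinearMap.fst ℂ E E)) :=
      (hT.comp_clm (ContinuousLinearMap.fst ℂ E E)).clm_comp (ContinuousLinearMap.inl ℂ E E)
    have h2 : IsCompactOperator ((ContinuousLinearMap.inr ℂ E E) ∘ T ∘ (ContinuousLinearMap.snd ℂ E E)) :=
      (hT.comp_clm (ContinuousLinearMap.snd ℂ E E)).clm_comp (ContinuousLinearMap.inr ℂ E E)
    have heq : ⇑S = (ContinuousLinearMap.inl ℂ E E) ∘ T ∘ (ContinuousLinearMap.fst ℂ E E) +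
        (ContinuousLinearMap.inr ℂ E E) ∘ T ∘ (ContinuousLinearMap.snd ℂ E E) := by
      funext x
      simp [hS, Prod.map]
    rw [heq]
    exact h1.add h2
  set C : E × E →L[ℂ] E × E := Ring.inverse (linearization H T K ζ₀) * S with hC
  have hCc : IsCompactOperator C := hSc.clm_comp _
  have hfac : ∀ ζ, linearization H T K ζ = linearization H T K ζ₀ * (1 + (ζ - ζ₀) • C) := by
    intro ζ
    rw [linearization_sub ζ ζ₀, mul_add, mul_one, mul_smul_comm, hC, ← mul_assoc,
      Ring.mul_inverse_cancel _ hL₀, one_mul]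
  have hunit : ∀ ζ, IsUnit (1 + (ζ - ζ₀) • C) ↔ IsUnit (quadPencil H T K ζ) := by
    intro ζ
    rw [← isUnit_linearization_iff, hfac]
    obtain ⟨U, hU⟩ := hL₀
    rw [← hU, Units.isUnit_units_mul]
  have hinv : ∀ ζ, IsUnit (quadPencil H T K ζ) → Ring.inverse (1 + (ζ - ζ₀) • C) * C =
      Ring.inverse (linearization H T K ζ) * S := by
    intro ζ hζ
    have h1 := (hunit ζ).mpr hζ
    have h2 : linearization H T K ζ * (Ring.inverse (1 + (ζ - ζ₀) • C) * C) = S := by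
      rw [hfac, mul_assoc, ← mul_assoc (1 + (ζ - ζ₀) • C), Ring.mul_inverse_cancel _ h1, one_mul,
        hC, ← mul_assoc, Ring.mul_inverse_cancel _ hL₀, one_mul]
    calc Ring.inverse (1 + (ζ - ζ₀) • C) * C
        = Ring.inverse (linearization H T K ζ) * linearization H T K ζ *
            (Ring.inverse (1 + (ζ - ζ₀) • C) * C) := by
          rw [Ring.inverse_mul_cancel _ (isUnit_linearization_iff.mpr hζ), one_mul]
      _ = _ := by rw [mul_assoc, h2]
  obtain ⟨N, hNfd, hN, hiso, htrace⟩ := linearPencil_trace hCc hw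
  refine ⟨Module.finrank ℂ N, ?_, ?_, ?_⟩
  · have hLinj := (ContinuousLinearMap.isUnit_iff_bijective.mp hL₀).1
    have hkerL : ∀ x, linearization H T K w x = 0 → (1 + (w - ζ₀) • C) x = 0 := by
      intro x hx
      apply hLinj
      rw [map_zero, ← hx, hfac w]
      rfl
    have hx₀ : linearization H T K w (f₀, (H + w • T) f₀) = 0 := by
      rw [linearization_apply, sub_self]
      exact Prod.ext rfl hker
    have hm₀ : (f₀, (H + w • T) f₀) ∈ N := hN 1 _ (by rw [pow_one]; exact hkerL _ hx₀)
    have hne₀ : (f₀, (H + w • T) f₀) ≠ 0 := fun h => hf₀ (congrArg Prod.fst h)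
    have hpair : ∃ x₁ ∈ N, ∀ a : ℂ, a • (f₀, (H + w • T) f₀) ≠ x₁ := by
      rcases hf₁ with h1 | ⟨h1, h1'⟩
      -- A Jordan chain of the quadratic pencil lifts to one of the linearization, whose derivative
      -- is `S`. The extra term `T f₀` comes from differentiating `(H + ζT)f` along the chain.
      · have hx₁ : linearization H T K w (f₁, (H + w • T) f₁ + T f₀) =
            -S (f₀, (H + w • T) f₀) := by
          have hcomm : (H + w • T) (T f₀) = T ((H + w • T) f₀) := by
            have h := congrArg (fun f : E →L[ℂ] E => f f₀) hHT.eq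
            simp only [mul_apply_eq_comp] at h
            simp [h]
          rw [quadPencil_apply] at h1
          rw [linearization_apply]
          refine Prod.ext ?_ ?_
          · simp [hS]
          · change (H + w • T) ((H + w • T) f₁ + T f₀) - K f₁ = -T ((H + w • T) f₀)
            rw [map_add (H + w • T), add_sub_right_comm, h1, ← hcomm]
            module
        have hCx : (1 + (w - ζ₀) • C) (f₁, (H + w • T) f₁ + T f₀) =
            -C (f₀, (H + w • T) f₀) := by
          apply hLinj
          rw [← mul_apply_eq_comp, ← hfac, hx₁, map_neg, hC, ← mul_apply_eq_comp, ← mul_assoc,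
            Ring.mul_inverse_cancel _ hL₀, one_mul]
        have hC0 : (1 + (w - ζ₀) • C) (C (f₀, (H + w • T) f₀)) = 0 := by
          have h2 : (1 + (w - ζ₀) • C) * C = C * (1 + (w - ζ₀) • C) := by
            rw [add_mul, mul_add, one_mul, mul_one, smul_mul_assoc, mul_smul_comm]
          rw [← mul_apply_eq_comp, h2, mul_apply_eq_comp, hkerL _ hx₀, map_zero]
        refine ⟨(f₁, (H + w • T) f₁ + T f₀), hN 2 _ ?_, ?_⟩
        · rw [pow_two, mul_apply_eq_comp, hCx, map_neg, hC0, neg_zero]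
        -- Were the second vector a multiple of the null vector `(f₀, (H + wT)f₀)`, `C` would kill
        -- the latter; but `1 + (w - ζ₀)C` kills it too, so it would be zero.
        · intro a ha
          rw [← ha, map_smul, hkerL _ hx₀, smul_zero] at hCx
          apply hne₀
          have h4 : C (f₀, (H + w • T) f₀) = 0 := neg_eq_zero.mp hCx.symm
          have h5 := hkerL _ hx₀
          rw [add_apply, smul_apply, h4, smul_zero, add_zero] at h5
          exact h5
      · refine ⟨(f₁, (H + w • T) f₁), hN 1 _ ?_, fun a ha => h1' a (congrArg Prod.fst ha)⟩
        rw [pow_one]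
        apply hkerL
        rw [linearization_apply, sub_self]
        exact Prod.ext rfl h1
    obtain ⟨x₁, hx₁, hind⟩ := hpair
    have hli : LinearIndependent ℂ ![(⟨_, hm₀⟩ : N), ⟨x₁, hx₁⟩] := by
      rw [LinearIndependent.pair_iff' (fun h => hne₀ (congrArg Subtype.val h))]
      exact fun a ha => hind a (congrArg Subtype.val ha)
    simpa using hli.fintype_card_le_finrank
  · filter_upwards [hiso] with ζ hζ using (hunit ζ).mp hζ
  · intro c r hwb hdisc
    have hr : 0 ≤ r := (Metric.pos_of_mem_ball hwb).le
    have hdisc' : ∀ s ∈ Metric.sphere c r, IsUnit (quadPencil H T K s) := by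
      intro s hs
      refine hdisc s (Metric.sphere_subset_closedBall hs) ?_
      rintro rfl
      exact (Metric.mem_ball.mp hwb).ne hs
    obtain ⟨hfin, htr⟩ := htrace c r hwb fun s hs hsw => (hunit s).mpr (hdisc s hs hsw)
    set B : ℂ → (E × E →L[ℂ] E × E) := fun ζ => Ring.inverse (linearization H T K ζ) * S with hB
    have hBcont : ContinuousOn B (Metric.sphere c r) := by
      intro s hs
      have h1 : DifferentiableAt ℂ (fun ζ => linearization H T K ζ) s := by
        unfold linearization
        fun_prop
      have h2 := (h1.inverse (isUnit_linearization_iff.mpr (hdisc' s hs))).mul_const S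
      exact h2.continuousAt.continuousWithinAt
    have hBint : ∀ g : ℂ → ℂ, Differentiable ℂ g → CircleIntegrable (fun ζ => g ζ • B ζ) c r :=
      fun g hg => (hg.continuous.continuousOn.smul hBcont).circleIntegrable hr
    have hBfin : ∀ g : ℂ → ℂ, Differentiable ℂ g → FiniteDimensional ℂ
        (LinearMap.range (∮ ζ in C(c, r), g ζ • B ζ).toLinearMap) := by
      intro g hg
      have h1 : (∮ ζ in C(c, r), g ζ • B ζ) =
          ∮ s in C(c, r), g s • (Ring.inverse (1 + (s - ζ₀) • C) * C) :=
        circleIntegral.integral_congr hr fun s hs => by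
          simp only [hB]
          rw [hinv s (hdisc' s hs)]
      rw [h1]
      exact hfin g hg
    have hBtr : finiteRankTrace (∮ ζ in C(c, r), B ζ).toLinearMap =
        2 * Real.pi * I * Module.finrank ℂ N := by
      rw [← htr]
      congr 2
      exact circleIntegral.integral_congr hr fun s hs => (hinv s (hdisc' s hs)).symm
    have hblock : ∀ (p : E × E →L[ℂ] E) (i : E →L[ℂ] E × E) (g : ℂ → ℂ), Differentiable ℂ g →
        (∮ ζ in C(c, r), p.comp ((g ζ • B ζ).comp i)) =
          p.comp ((∮ ζ in C(c, r), g ζ • B ζ).comp i) := fun p i g hg =>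
      circleIntegral_clm_comp_comm ((ContinuousLinearMap.compL ℂ E (E × E) E p).comp
        ((ContinuousLinearMap.compL ℂ E (E × E) (E × E)).flip i)) (hBint g hg)
    have hblock_fin : ∀ (p : E × E →L[ℂ] E) (i : E →L[ℂ] E × E) (g : ℂ → ℂ), Differentiable ℂ g →
        FiniteDimensional ℂ (LinearMap.range
          (∮ ζ in C(c, r), p.comp ((g ζ • B ζ).comp i)).toLinearMap) := by
      intro p i g hg
      rw [hblock p i g hg]
      have := hBfin g hg
      have : FiniteDimensional ℂ
          (LinearMap.range ((∮ ζ in C(c, r), g ζ • B ζ).comp i).toLinearMap) :=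
        finiteDimensional_range_comp_right (∮ ζ in C(c, r), g ζ • B ζ).toLinearMap i.toLinearMap
      exact finiteDimensional_range_comp_left _ p.toLinearMap
    -- `F` is the off-diagonal block of `B`. Its moments `G₀` and `G₁` have finite rank, and the
    -- integrals of both diagonal blocks are expressed through them.
    set F : ℂ → (E →L[ℂ] E) := fun ζ => Ring.inverse (quadPencil H T K ζ) * T with hF
    have hFB : ∀ ζ ∈ Metric.sphere c r, F ζ =
        (ContinuousLinearMap.fst ℂ E E).comp ((B ζ).comp (ContinuousLinearMap.inr ℂ E E)) := by
      intro ζ hζ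
      ext v
      have h1 : B ζ (0, v) = Ring.inverse (linearization H T K ζ) (0, T v) := by
        simp [hB, hS]
      change _ = (B ζ (0, v)).1
      rw [h1, ringInverse_linearization_apply (hdisc' ζ hζ)]
      simp [hF]
    have hFcont : ∀ g : ℂ → ℂ, Differentiable ℂ g →
        ContinuousOn (fun ζ => g ζ • F ζ) (Metric.sphere c r) := by
      intro g hg s hs
      have h1 : DifferentiableAt ℂ (fun ζ => quadPencil H T K ζ) s := by
        unfold quadPencil
        fun_prop
      exact ((hg s).smul
        ((h1.inverse (hdisc' s hs)).mul_const T)).continuousAt.continuousWithinAt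
    have hFint : ∀ g : ℂ → ℂ, Differentiable ℂ g → CircleIntegrable (fun ζ => g ζ • F ζ) c r :=
      fun g hg => (hFcont g hg).circleIntegrable hr
    have hFfin : ∀ g : ℂ → ℂ, Differentiable ℂ g → FiniteDimensional ℂ
        (LinearMap.range (∮ ζ in C(c, r), g ζ • F ζ).toLinearMap) := by
      intro g hg
      have h1 : (∮ ζ in C(c, r), g ζ • F ζ) = ∮ ζ in C(c, r), (ContinuousLinearMap.fst ℂ E E).comp
          ((g ζ • B ζ).comp (ContinuousLinearMap.inr ℂ E E)) :=
        circleIntegral.integral_congr hr fun s hs => by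
          simp only [hFB s hs, ContinuousLinearMap.smul_comp, ContinuousLinearMap.comp_smul]
      rw [h1]
      exact hblock_fin _ _ g hg
    have hone : Differentiable ℂ (fun _ : ℂ => (1 : ℂ)) := differentiable_const 1
    have hid : Differentiable ℂ (fun ζ : ℂ => ζ) := differentiable_id
    set G₀ : E →L[ℂ] E := ∮ ζ in C(c, r), (1 : ℂ) • F ζ with hG₀
    set G₁ : E →L[ℂ] E := ∮ ζ in C(c, r), ζ • F ζ with hG₁
    have hG₀fin : FiniteDimensional ℂ (LinearMap.range G₀.toLinearMap) := hFfin _ hone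
    have hG₁fin : FiniteDimensional ℂ (LinearMap.range G₁.toLinearMap) := hFfin _ hid
    have hright : ∀ (g : ℂ → ℂ) (X : E →L[ℂ] E), Differentiable ℂ g →
        (∮ ζ in C(c, r), (g ζ • F ζ) * X) = (∮ ζ in C(c, r), g ζ • F ζ) * X := fun g X hg =>
      circleIntegral_clm_comp_comm ((ContinuousLinearMap.mul ℂ (E →L[ℂ] E)).flip X) (hFint g hg)
    have hleft : ∀ (g : ℂ → ℂ) (X : E →L[ℂ] E), Differentiable ℂ g →
        (∮ ζ in C(c, r), X * (g ζ • F ζ)) = X * (∮ ζ in C(c, r), g ζ • F ζ) := fun g X hg =>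
      circleIntegral_clm_comp_comm (ContinuousLinearMap.mul ℂ (E →L[ℂ] E) X) (hFint g hg)
    have hrightint : ∀ (g : ℂ → ℂ) (X : E →L[ℂ] E), Differentiable ℂ g →
        CircleIntegrable (fun ζ => (g ζ • F ζ) * X) c r := fun g X hg =>
      ((hFcont g hg).mul continuousOn_const).circleIntegrable hr
    have hleftint : ∀ (g : ℂ → ℂ) (X : E →L[ℂ] E), Differentiable ℂ g →
        CircleIntegrable (fun ζ => X * (g ζ • F ζ)) c r := fun g X hg =>
      (continuousOn_const.mul (hFcont g hg)).circleIntegrable hr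
    have hX : (∮ ζ in C(c, r), F ζ * (H + ζ • T)) = G₀ * H + G₁ * T := by
      rw [hG₀, hG₁, ← hright _ H hone, ← hright _ T hid,
        ← circleIntegral.integral_add (hrightint _ H hone) (hrightint _ T hid)]
      congr 1
      funext ζ
      rw [mul_add, one_smul, mul_smul_comm, smul_mul_assoc]
    have hY : (∮ ζ in C(c, r), (H + ζ • T) * F ζ) = H * G₀ + T * G₁ := by
      rw [hG₀, hG₁, ← hleft _ H hone, ← hleft _ T hid,
        ← circleIntegral.integral_add (hleftint _ H hone) (hleftint _ T hid)]
      congr 1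
      funext ζ
      rw [add_mul, one_smul, mul_smul_comm, smul_mul_assoc]
    set Z : E × E →L[ℂ] E × E := ∮ ζ in C(c, r), B ζ with hZ
    have hZfin : FiniteDimensional ℂ (LinearMap.range Z.toLinearMap) := by
      have h1 : (∮ ζ in C(c, r), (1 : ℂ) • B ζ) = Z := by simp only [one_smul, hZ]
      rw [← h1]
      exact hBfin _ hone
    have hblock1 : ∀ (p : E × E →L[ℂ] E) (i : E →L[ℂ] E × E),
        p.comp (Z.comp i) = ∮ ζ in C(c, r), p.comp ((B ζ).comp i) := fun p i => by
      have := hblock p i _ hone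
      simp only [one_smul] at this
      exact this.symm
    have hZX : (ContinuousLinearMap.fst ℂ E E).comp (Z.comp (ContinuousLinearMap.inl ℂ E E)) =
        G₀ * H + G₁ * T := by
      rw [hblock1, ← hX]
      refine circleIntegral.integral_congr hr fun ζ hζ => ?_
      ext u
      have h1 : B ζ (u, 0) = Ring.inverse (linearization H T K ζ) (T u, 0) := by
        simp [hB, hS]
      change (B ζ (u, 0)).1 = Ring.inverse (quadPencil H T K ζ) (T ((H + ζ • T) u))
      rw [h1, ringInverse_linearization_apply (hdisc' ζ hζ), zero_add]
      have hc : Commute (H + ζ • T) T := hHT.add_left ((Commute.refl T).smul_left ζ)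
      exact congrArg _ (congrArg (fun f : E →L[ℂ] E => f u) hc.eq)
    have hZY : (ContinuousLinearMap.snd ℂ E E).comp (Z.comp (ContinuousLinearMap.inr ℂ E E)) =
        H * G₀ + T * G₁ := by
      rw [hblock1, ← hY]
      refine circleIntegral.integral_congr hr fun ζ hζ => ?_
      ext v
      have h1 : B ζ (0, v) = Ring.inverse (linearization H T K ζ) (0, T v) := by
        simp [hB, hS]
      change (B ζ (0, v)).2 = (H + ζ • T) (Ring.inverse (quadPencil H T K ζ) (T v))
      rw [h1, ringInverse_linearization_apply (hdisc' ζ hζ), map_zero, add_zero, sub_zero]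
    have f1 := finiteDimensional_range_comp_right G₀.toLinearMap H.toLinearMap
    have f2 := finiteDimensional_range_comp_right G₁.toLinearMap T.toLinearMap
    have f3 := finiteDimensional_range_comp_left G₀.toLinearMap H.toLinearMap
    have f4 := finiteDimensional_range_comp_left G₁.toLinearMap T.toLinearMap
    -- Cyclicity is applied after integration, moment by moment, since the integrands need not have
    -- finite rank. The two diagonal blocks thus contribute equally, which accounts for the factor
    -- `2` in the derivative of the quadratic pencil.
    have htrXY : finiteRankTrace (G₀ * H + G₁ * T).toLinearMap =
        finiteRankTrace (H * G₀ + T * G₁).toLinearMap := by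
      have h1 := finiteRankTrace_add (G₀.toLinearMap ∘ₗ H.toLinearMap)
        (G₁.toLinearMap ∘ₗ T.toLinearMap)
      have h2 := finiteRankTrace_add (H.toLinearMap ∘ₗ G₀.toLinearMap)
        (T.toLinearMap ∘ₗ G₁.toLinearMap)
      rw [← finiteRankTrace_comp_comm G₀.toLinearMap, ← finiteRankTrace_comp_comm G₁.toLinearMap,
        ← h2] at h1
      exact h1
    have htrZ : finiteRankTrace Z.toLinearMap = finiteRankTrace (G₀ * H + G₁ * T).toLinearMap +
        finiteRankTrace (H * G₀ + T * G₁).toLinearMap := by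
      have g1 := finiteDimensional_range_comp_right Z.toLinearMap (LinearMap.inl ℂ E E)
      have g2 := finiteDimensional_range_comp_right Z.toLinearMap (LinearMap.inr ℂ E E)
      have g3 := finiteDimensional_range_comp_right (Z.toLinearMap ∘ₗ LinearMap.inl ℂ E E)
        (LinearMap.fst ℂ E E)
      have g4 := finiteDimensional_range_comp_right (Z.toLinearMap ∘ₗ LinearMap.inr ℂ E E)
        (LinearMap.snd ℂ E E)
      have h1 := finiteRankTrace_add ((Z.toLinearMap ∘ₗ LinearMap.inl ℂ E E) ∘ₗ LinearMap.fst ℂ E E)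
        ((Z.toLinearMap ∘ₗ LinearMap.inr ℂ E E) ∘ₗ LinearMap.snd ℂ E E)
      rw [← finiteRankTrace_comp_comm (Z.toLinearMap ∘ₗ LinearMap.inl ℂ E E),
        ← finiteRankTrace_comp_comm (Z.toLinearMap ∘ₗ LinearMap.inr ℂ E E)] at h1
      rw [← hZX, ← hZY]
      refine Eq.trans ?_ h1
      congr 1
      refine LinearMap.ext fun x => ?_
      change Z x = Z (x.1, 0) + Z (0, x.2)
      rw [← map_add, Prod.mk_add_mk, add_zero, zero_add]
    have hfinX : FiniteDimensional ℂ (LinearMap.range (G₀ * H + G₁ * T).toLinearMap) := by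
      rw [← hZX]
      have := finiteDimensional_range_comp_right Z.toLinearMap (LinearMap.inl ℂ E E)
      exact finiteDimensional_range_comp_left (Z.toLinearMap ∘ₗ LinearMap.inl ℂ E E)
        (LinearMap.fst ℂ E E)
    have hgoal : (∮ ζ in C(c, r), Ring.inverse (quadPencil H T K ζ) *
        ((2 : ℂ) • (T * (H + ζ • T))) : E →L[ℂ] E) =
          (G₀ * H + G₁ * T) + (G₀ * H + G₁ * T) := by
      rw [← two_smul ℂ (G₀ * H + G₁ * T), ← hX, ← circleIntegral.integral_smul]
      congr 1
      funext ζ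
      rw [mul_smul_comm, ← mul_assoc]
    rw [hgoal]
    refine ⟨Submodule.finiteDimensional_of_le
      (S₂ := LinearMap.range (G₀ * H + G₁ * T).toLinearMap) ?_, ?_⟩
    · rintro _ ⟨x, rfl⟩
      exact Submodule.add_mem _ ⟨x, rfl⟩ ⟨x, rfl⟩
    · have h1 := finiteRankTrace_add (G₀ * H + G₁ * T).toLinearMap (G₀ * H + G₁ * T).toLinearMap
      refine h1.trans ?_
      rw [← hBtr, htrZ, ← htrXY]

end QuadraticPencil

/-! ### Diagonal and permutation operators in a Hilbert basis -/

section Diagonal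

open Filter Topology

variable {ι E : Type*} [NormedAddCommGroup E] [InnerProductSpace ℂ E]

lemma hilbertBasis_ext (b : HilbertBasis ι ℂ E) {x y : E} (h : ∀ n, b.repr x n = b.repr y n) :
    x = y :=
  b.repr.injective (lp.ext (funext h))

open Classical in
lemma repr_self_apply (b : HilbertBasis ι ℂ E) (m n : ι) :
    b.repr (b m) n = if n = m then 1 else 0 := by
  rw [b.repr_self, lp.single_apply, Pi.single_apply]

/-- Bounded scalar sequences. -/
def BddSeq (d : ι → ℂ) : Prop := BddAbove (Set.range fun n => ‖d n‖)

lemma bddSeq_of_le {d : ι → ℂ} {C : ℝ} (h : ∀ n, ‖d n‖ ≤ C) : BddSeq d :=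
  ⟨C, by rintro _ ⟨n, rfl⟩; exact h n⟩

lemma bddSeq_of_tendsto {d : ι → ℂ} {a : ℂ} (h : Tendsto d cofinite (𝓝 a)) : BddSeq d := by
  obtain ⟨C, hC⟩ := (Metric.isBounded_range_of_tendsto_cofinite h).exists_norm_le
  exact bddSeq_of_le fun n => hC _ ⟨n, rfl⟩

open Classical in
/-- The operator that is diagonal in a Hilbert basis, with the given bounded diagonal entries. -/
def diagOp (b : HilbertBasis ι ℂ E) (d : ι → ℂ) : E →L[ℂ] E :=
  if h : BddSeq d then
    (b.repr.symm.toContinuousLinearEquiv : _ →L[ℂ] E) ∘L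
      (lp.holderL (p := ⊤) (q := 2) 2 (K := 1) (fun _ : ι => ContinuousLinearMap.mul ℂ ℂ)
        (fun _ => by simp) ⟨d, memℓp_infty h⟩) ∘L
      (b.repr.toContinuousLinearEquiv : E →L[ℂ] _)
  else 0

lemma repr_diagOp (b : HilbertBasis ι ℂ E) {d : ι → ℂ} (hd : BddSeq d) (x : E) (n : ι) :
    b.repr (diagOp b d x) n = d n * b.repr x n := by
  rw [diagOp, dif_pos hd]
  change b.repr (b.repr.symm _) n = _
  rw [LinearIsometryEquiv.apply_symm_apply]
  rfl

lemma norm_diagOp_le (b : HilbertBasis ι ℂ E) {d : ι → ℂ} {C : ℝ} (hC : 0 ≤ C)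
    (hd : ∀ n, ‖d n‖ ≤ C) : ‖diagOp b d‖ ≤ C := by
  refine ContinuousLinearMap.opNorm_le_bound _ hC fun x => ?_
  rw [← b.repr.norm_map, ← b.repr.norm_map x]
  have h2 : (0 : ℝ) < (2 : ENNReal).toReal := by norm_num
  refine lp.norm_le_of_forall_sum_le h2 (by positivity) fun s => ?_
  have hsum := lp.sum_rpow_le_norm_rpow h2 (b.repr x) s
  calc ∑ i ∈ s, ‖b.repr (diagOp b d x) i‖ ^ (2 : ENNReal).toReal
      ≤ ∑ i ∈ s, C ^ (2 : ENNReal).toReal * ‖b.repr x i‖ ^ (2 : ENNReal).toReal := by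
        refine Finset.sum_le_sum fun i _ => ?_
        rw [repr_diagOp b (bddSeq_of_le hd), norm_mul,
          Real.mul_rpow (norm_nonneg _) (norm_nonneg _)]
        gcongr
        exact hd i
    _ ≤ _ := by
        rw [← Finset.mul_sum, Real.mul_rpow hC (norm_nonneg _)]
        gcongr

/-- Truncations to finitely many basis vectors have finite rank and converge in norm. -/
lemma isCompactOperator_diagOp [CompleteSpace E] (b : HilbertBasis ι ℂ E) {d : ι → ℂ}
    (hd : Tendsto d cofinite (𝓝 0)) : IsCompactOperator (diagOp b d) := by
  classical
  have hb := bddSeq_of_tendsto hd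
  set F : Finset ι → (E →L[ℂ] E) := fun s =>
    ∑ n ∈ s, (innerSL ℂ (b n)).smulRight (d n • b n) with hF
  have hFc : ∀ s, IsCompactOperator (F s) := by
    intro s
    induction s using Finset.induction with
    | empty => simpa [hF] using! isCompactOperator_zero
    | insert a s ha ih =>
      have h1 : F (insert a s) = (innerSL ℂ (b a)).smulRight (d a • b a) + F s := by
        simp only [hF]
        rw [Finset.sum_insert ha]
      rw [h1]
      refine IsCompactOperator.add ?_ ih
      exact ((isCompactOperator_id (E := ℂ)).comp_clm (innerSL ℂ (b a))).clm_comp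
        (ContinuousLinearMap.toSpanSingleton ℂ (d a • b a))
  have hrepr : ∀ s x n, b.repr (F s x) n = if n ∈ s then d n * b.repr x n else 0 := by
    intro s x n
    have h1 : F s x = ∑ m ∈ s, (b.repr x m * d m) • b m := by
      simp only [hF, sum_apply]
      refine Finset.sum_congr rfl fun m _ => ?_
      rw [b.repr_apply_apply, ← smul_smul]
      rfl
    rw [h1, map_sum, lp.coeFn_sum, Finset.sum_apply]
    simp only [map_smul, lp.coeFn_smul, Pi.smul_apply, repr_self_apply, smul_eq_mul, mul_ite,
      mul_one, mul_zero, Finset.sum_ite_eq]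
    split_ifs
    · rw [mul_comm]
    · rfl
  refine isCompactOperator_of_tendsto (l := atTop) (F := F) ?_ (Eventually.of_forall hFc)
  rw [Metric.tendsto_atTop]
  intro ε hε
  have hev : ∀ᶠ n in cofinite, ‖d n‖ < ε / 2 := by
    have := hd.norm
    rw [norm_zero] at this
    exact this.eventually_lt_const (by positivity)
  refine ⟨(eventually_cofinite.mp hev).toFinset, fun s hs => ?_⟩
  have hbd : ∀ n, ‖(if n ∈ s then 0 else -d n : ℂ)‖ ≤ ε / 2 := by
    intro n
    split_ifs with h
    · rw [norm_zero]
      positivity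
    · rw [norm_neg]
      by_contra hn
      refine h (hs ?_)
      rw [Set.Finite.mem_toFinset]
      exact fun h' => hn (le_of_lt h')
  have heq : F s - diagOp b d = diagOp b (fun n => if n ∈ s then 0 else -d n) := by
    ext x
    apply hilbertBasis_ext b
    intro n
    rw [repr_diagOp b (bddSeq_of_le hbd), sub_apply, map_sub, lp.coeFn_sub, Pi.sub_apply, hrepr,
      repr_diagOp b hb]
    split_ifs <;> simp
  rw [dist_eq_norm, heq]
  exact (norm_diagOp_le b (by positivity) hbd).trans_lt (by linarith)

/-- The unitary operator that permutes the elements of a Hilbert basis. -/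
theorem exists_permOp (b : HilbertBasis ι ℂ E) [CompleteSpace E] (σ : Equiv.Perm ι) :
    ∃ R : E →L[ℂ] E, ∀ x n, b.repr (R x) (σ n) = b.repr x n := by
  have ho : Orthonormal ℂ (fun n => b (σ n)) := b.orthonormal.comp σ σ.injective
  have hsp : ⊤ ≤ (Submodule.span ℂ (Set.range fun n => b (σ n))).topologicalClosure := by
    have h1 : Set.range (fun n => b (σ n)) = Set.range b := σ.surjective.range_comp b
    rw [h1, b.dense_span]
  set b' := HilbertBasis.mk ho hsp with hb'
  refine ⟨(b'.repr.symm.toContinuousLinearEquiv : _ →L[ℂ] E) ∘L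
      (b.repr.toContinuousLinearEquiv : E →L[ℂ] lp (fun _ : ι => ℂ) 2), fun x n => ?_⟩
  have h1 : b (σ n) = b' n := by rw [hb', HilbertBasis.coe_mk]
  rw [b.repr_apply_apply, h1, ← b'.repr_apply_apply]
  change b'.repr (b'.repr.symm (b.repr x)) n = _
  rw [LinearIsometryEquiv.apply_symm_apply]

/-- The Fredholm alternative on a closed invariant subspace. -/
lemma exists_sub_eq_of_invariant {F : Type*} [NormedAddCommGroup F] [NormedSpace ℂ F]
    [CompleteSpace F] {K : F →L[ℂ] F} (hK : IsCompactOperator K) (G : Submodule ℂ F)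
    (hG : IsClosed (G : Set F)) (hinv : ∀ x ∈ G, K x ∈ G)
    (hinj : ∀ x ∈ G, x - K x = 0 → x = 0) {y : F} (hy : y ∈ G) : ∃ x ∈ G, x - K x = y := by
  have := hG.completeSpace_coe
  set K' : G →L[ℂ] G := -(K.restrict hinv) with hK'
  have hc : IsCompactOperator K' :=
    (IsCompactOperator.restrict (f := K.toLinearMap) hK hinv hG).neg
  have hu := isUnit_one_add_of_injective hc fun x hx => by
    refine Subtype.ext (hinj x x.2 ?_)
    have := congrArg Subtype.val hx
    rw [sub_eq_add_neg]
    exact this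
  obtain ⟨x, hx⟩ := (ContinuousLinearMap.isUnit_iff_bijective.mp hu).2 ⟨y, hy⟩
  refine ⟨x, x.2, ?_⟩
  rw [sub_eq_add_neg]
  exact congrArg Subtype.val hx

end Diagonal

/-! ### Threefold symmetry forces a Jordan chain or two null vectors -/

section Sectors

open Filter Topology

variable {ι E : Type*} [NormedAddCommGroup E] [InnerProductSpace ℂ E] [CompleteSpace E]

lemma tendsto_inv_of_tendsto_norm_atTop {q : ι → ℂ}
    (hq : Tendsto (fun n => ‖q n‖) cofinite atTop) : Tendsto (fun n => (q n)⁻¹) cofinite (𝓝 0) := by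
  rw [tendsto_zero_iff_norm_tendsto_zero]
  simp only [norm_inv]
  exact tendsto_inv_atTop_zero.comp hq

/-- For an operator with a threefold rotational symmetry, the pencil `(H + ζ T)² - W T²` has, at a
fixed point `k` of the symmetry, a Jordan chain of length two or two independent null vectors. -/
theorem exists_jordan_chain (b : HilbertBasis ι ℂ E) (σ : Equiv.Perm ι) {R W : E →L[ℂ] E}
    (hR : ∀ x n, b.repr (R x) (σ n) = b.repr x n) {q : ι → ℂ} {η k k₁ : ℂ} (hη3 : η ^ 3 = 1)
    (hη1 : η ≠ 1) (hqσ : ∀ n, q (σ n) = η ^ 2 * q n) {n₀ : ι} (hn₀ : ∀ n, q n = 0 ↔ n = n₀)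
    (hσ : σ n₀ = n₀) (hq : Tendsto (fun n => ‖q n‖) cofinite atTop)
    (hq₁ : ∀ n, q n + (k₁ - k) ≠ 0) (hWR : ∀ x, W (R x) = η • R (W x)) {T : E →L[ℂ] E}
    (hT : ∀ x n, b.repr (T x) n = (q n + (k₁ - k))⁻¹ * b.repr x n) :
    ∃ f₀ f₁ : E, f₀ ≠ 0 ∧ quadPencil (1 - k₁ • T) T (W * T * T) k f₀ = 0 ∧
      (quadPencil (1 - k₁ • T) T (W * T * T) k f₁ = -(2 : ℂ) • (1 - k₁ • T + k • T) (T f₀) ∨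
        (quadPencil (1 - k₁ • T) T (W * T * T) k f₁ = 0 ∧ ∀ c : ℂ, c • f₀ ≠ f₁)) := by
  have hη0 : η ≠ 0 := by
    rintro rfl
    norm_num at hη3
  have hηinv : (η ^ 2)⁻¹ = η := by
    refine inv_eq_of_mul_eq_one_right ?_
    rw [← pow_succ, hη3]
  set δ : ℂ := k₁ - k with hδ
  have hδ0 : δ ≠ 0 := by
    have := hq₁ n₀
    rwa [(hn₀ n₀).mpr rfl, zero_add] at this
  have hinv := tendsto_inv_of_tendsto_norm_atTop hq
  have hinv2 : Tendsto (fun n => (q n)⁻¹ * (q n)⁻¹) cofinite (𝓝 0) := by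
    simpa using hinv.mul hinv
  have hM : Tendsto (fun n => (1 + δ * (q n)⁻¹) * (1 + δ * (q n)⁻¹)) cofinite (𝓝 1) := by
    have := (hinv.const_mul δ).const_add 1
    simpa using this.mul this
  have hMb : BddSeq fun n => (q n + δ) ^ 2 * ((q n)⁻¹ * (q n)⁻¹) := by
    obtain ⟨C, hC⟩ := bddSeq_of_tendsto hM
    refine bddSeq_of_le (C := C) fun n => ?_
    refine le_trans ?_ (hC ⟨n, rfl⟩)
    by_cases h : q n = 0
    · simp [h]
    · refine le_of_eq (congrArg _ ?_)
      field_simp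
  -- Since `0⁻¹ = 0`, these three multipliers vanish at `n₀`; elsewhere they are `(q + δ)²/q²`,
  -- `1/q²` and `1/q`. The symbol of `T` is `(q + δ)⁻¹`, so `T² M = S`.
  set M := diagOp b fun n => (q n + δ) ^ 2 * ((q n)⁻¹ * (q n)⁻¹)
  set S := diagOp b fun n => (q n)⁻¹ * (q n)⁻¹
  set S₁ := diagOp b fun n => (q n)⁻¹
  have hMr : ∀ x n, b.repr (M x) n = (q n + δ) ^ 2 * ((q n)⁻¹ * (q n)⁻¹) * b.repr x n :=
    repr_diagOp b hMb
  have hSr : ∀ x n, b.repr (S x) n = (q n)⁻¹ * (q n)⁻¹ * b.repr x n :=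
    repr_diagOp b (bddSeq_of_tendsto hinv2)
  have hS₁r : ∀ x n, b.repr (S₁ x) n = (q n)⁻¹ * b.repr x n :=
    repr_diagOp b (bddSeq_of_tendsto hinv)
  have hext : ∀ {x y : E}, (∀ n, b.repr x (σ n) = b.repr y (σ n)) → x = y := fun h =>
    hilbertBasis_ext b fun n => by
      obtain ⟨m, rfl⟩ := σ.surjective n
      exact h m
  have hsmul : ∀ (c : ℂ) x n, b.repr (c • x) n = c * b.repr x n := fun c x n => by
    rw [map_smul]
    rfl
  have hadd : ∀ x y n, b.repr (x + y) n = b.repr x n + b.repr y n := fun x y n => by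
    rw [map_add]
    rfl
  have hsub : ∀ x y n, b.repr (x - y) n = b.repr x n - b.repr y n := fun x y n => by
    rw [map_sub]
    rfl
  have hzero : ∀ n, b.repr (0 : E) n = 0 := fun n => by
    rw [map_zero]
    rfl
  have hRS : ∀ x, R (S x) = η • S (R x) := fun x => hext fun n => by
    rw [hR, hSr, hsmul, hSr, hR, hqσ, mul_inv, hηinv]
    linear_combination (-(q n)⁻¹ * (q n)⁻¹ * b.repr x n) * hη3
  have hRS₁ : ∀ x, R (S₁ x) = η ^ 2 • S₁ (R x) := fun x => hext fun n => by
    rw [hR, hS₁r, hsmul, hS₁r, hR, hqσ, mul_inv, hηinv]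
    linear_combination (-(q n)⁻¹ * b.repr x n) * hη3
  have hRW : ∀ x, R (W x) = η ^ 2 • W (R x) := fun x => by
    rw [hWR, smul_smul, ← pow_succ, hη3, one_smul]
  have hRG : ∀ x, R ((W * S) x) = (W * S) (R x) := fun x => by
    change R (W (S x)) = W (S (R x))
    rw [hRW, hRS, map_smul, smul_smul, ← pow_succ, hη3, one_smul]
  have hK : IsCompactOperator (W * S : E →L[ℂ] E) := (isCompactOperator_diagOp b hinv2).clm_comp W
  -- the sectors, on which `R` acts as a scalar `c ≠ 1`
  set sec : ℂ → Submodule ℂ E := fun c => LinearMap.ker (R - c • 1 : E →L[ℂ] E).toLinearMap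
  have hsec : ∀ c x, x ∈ sec c ↔ R x = c • x := fun c x => by
    change (R - c • 1 : E →L[ℂ] E) x = 0 ↔ _
    rw [sub_apply, sub_eq_zero]
    rfl
  have hsec_closed : ∀ c, IsClosed (sec c : Set E) := fun c =>
    isClosed_singleton.preimage (R - c • 1 : E →L[ℂ] E).continuous
  have hsec_inv : ∀ c, ∀ x ∈ sec c, (W * S) x ∈ sec c := fun c x hx => by
    rw [hsec] at hx ⊢
    rw [hRG, hx, map_smul]
  -- `R` preserves the coefficient at the fixed index `n₀`, so an eigenvector for `c ≠ 1` has none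
  -- there.
  have hsec_n₀ : ∀ c, c ≠ 1 → ∀ x ∈ sec c, b.repr x n₀ = 0 := fun c hc x hx => by
    rw [hsec] at hx
    have h1 := hR x n₀
    rw [hσ, hx, hsmul] at h1
    have h2 : (c - 1) * b.repr x n₀ = 0 := by linear_combination h1
    exact (mul_eq_zero.mp h2).resolve_left (sub_ne_zero.mpr hc)
  have hη2 : η ^ 2 ≠ 1 := fun h => hη1 (by rw [← hη3, pow_succ, h, one_mul])
  have hηη : η ≠ η ^ 2 := fun h => hη1 (mul_left_cancel₀ hη0 (by rw [mul_one, ← sq, ← h]))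
  have ha : ∀ x n, b.repr ((1 - k₁ • T + k • T) x) n = q n * (q n + δ)⁻¹ * b.repr x n := by
    intro x n
    have h1 : (1 - k₁ • T + k • T) x = x - δ • T x := by
      simp only [add_apply, sub_apply, smul_apply, one_apply_eq_self, hδ, sub_smul]
      abel
    rw [h1, hsub, hsmul, hT]
    have := hq₁ n
    field_simp
    ring
  set A := quadPencil (1 - k₁ • T) T (W * T * T) k with hA
  have hAapp : ∀ x, A x = (1 - k₁ • T + k • T) ((1 - k₁ • T + k • T) x) - W (T (T x)) :=
    fun x => rfl
  -- Away from `n₀`, `M` inverts the square of `1 - k₁T + kT`, whose symbol is `q/(q + δ)`. The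
  -- equation for `A` thus becomes one for `1 - W S`, to which the Fredholm alternative applies.
  have hAM : ∀ g, b.repr g n₀ = 0 → A (M g) = g - (W * S) g := by
    intro g hg
    have h1 : (1 - k₁ • T + k • T) ((1 - k₁ • T + k • T) (M g)) = g := by
      refine hilbertBasis_ext b fun n => ?_
      rw [ha, ha, hMr]
      by_cases h : q n = 0
      · rw [(hn₀ n).mp h, hg]
        ring
      · have := hq₁ n
        field_simp
    have h2 : T (T (M g)) = S g := by
      refine hilbertBasis_ext b fun n => ?_
      rw [hT, hT, hMr, hSr]
      have := hq₁ n
      by_cases h : q n = 0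
      · simp [h]
      · field_simp
    rw [hAapp, h1, h2]
    rfl
  have haTM : ∀ g, (1 - k₁ • T + k • T) (T (M g)) = S₁ g := fun g => by
    refine hilbertBasis_ext b fun n => ?_
    rw [ha, hT, hMr, hS₁r]
    have := hq₁ n
    by_cases h : q n = 0
    · simp [h]
    · field_simp
  have hMinj : ∀ g, b.repr g n₀ = 0 → (∀ n, n ≠ n₀ → b.repr (M g) n = 0) → g = 0 := by
    intro g hg h
    refine hilbertBasis_ext b fun n => ?_
    rw [hzero]
    by_cases hn : n = n₀
    · rw [hn, hg]
    · have h1 := h n hn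
      have hqn : q n ≠ 0 := fun h' => hn ((hn₀ n).mp h')
      rw [hMr] at h1
      refine (mul_eq_zero.mp h1).resolve_left ?_
      exact mul_ne_zero (pow_ne_zero 2 (hq₁ n)) (mul_ne_zero (inv_ne_zero hqn) (inv_ne_zero hqn))
  have hqn₀ : q n₀ = 0 := (hn₀ n₀).mpr rfl
  have hbn : ∀ n, n ≠ n₀ → b.repr (b n₀) n = 0 := fun n hn => by
    rw [repr_self_apply, if_neg hn]
  have hbn₀ : b.repr (b n₀) n₀ = 1 := by rw [repr_self_apply, if_pos rfl]
  have hab : (1 - k₁ • T + k • T) (b n₀) = 0 := by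
    refine hilbertBasis_ext b fun n => ?_
    rw [ha, hzero]
    by_cases hn : n = n₀
    · simp [hn, hqn₀]
    · simp [hbn n hn]
  have hTb : T (b n₀) = δ⁻¹ • b n₀ := by
    refine hilbertBasis_ext b fun n => ?_
    rw [hT, hsmul]
    by_cases hn : n = n₀
    · rw [hn, hqn₀, zero_add]
    · rw [hbn n hn, mul_zero, mul_zero]
  have hRb : R (b n₀) = b n₀ := by
    refine hext fun n => ?_
    rw [hR]
    by_cases hn : n = n₀
    · rw [hn, hσ]
    · rw [hbn n hn, hbn]
      intro h
      exact hn (σ.injective (h.trans hσ.symm))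
  -- `A (b n₀) = -δ⁻² W (b n₀)` lies in the sector `η²`. If `1 - W S` is injective there, a vector
  -- `M g` corrects `δ² b n₀` to a null vector; if not, some `M g` is itself one.
  have hfirst : ∃ c : ℂ, ∃ g ∈ sec (η ^ 2), c • b n₀ + M g ≠ 0 ∧ A (c • b n₀ + M g) = 0 := by
    by_cases hinj : ∀ x ∈ sec (η ^ 2), x - (W * S) x = 0 → x = 0
    · have hmem : W (b n₀) ∈ sec (η ^ 2) := by
        rw [hsec, hRW, hRb]
      obtain ⟨g, hg, hgeq⟩ := exists_sub_eq_of_invariant hK (sec (η ^ 2)) (hsec_closed _)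
        (hsec_inv _) hinj hmem
      refine ⟨δ ^ 2, g, hg, fun h => ?_, ?_⟩
      · have h1 := congrArg (fun x => b.repr x n₀) h
        simp only [hadd, hsmul, hMr, hzero, hbn₀, hsec_n₀ _ hη2 g hg, mul_zero, add_zero,
          mul_one] at h1
        exact hδ0 (pow_eq_zero_iff two_ne_zero |>.mp h1)
      · rw [map_add, hAM g (hsec_n₀ _ hη2 g hg), hgeq, map_smul, hAapp, hab, map_zero, hTb,
          map_smul, hTb, smul_smul, map_smul, zero_sub, smul_neg, smul_smul]
        have : δ ^ 2 * (δ⁻¹ * δ⁻¹) = 1 := by field_simp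
        rw [this, one_smul, neg_add_cancel]
    · push Not at hinj
      obtain ⟨g, hg, hg0, hgne⟩ := hinj
      refine ⟨0, g, hg, fun h => hgne ?_, ?_⟩
      · rw [zero_smul, zero_add] at h
        refine hMinj g (hsec_n₀ _ hη2 g hg) fun n _ => ?_
        rw [h, hzero]
      · rw [zero_smul, zero_add, hAM g (hsec_n₀ _ hη2 g hg), hg0]
  obtain ⟨c, g, hg, hf₀, hAf₀⟩ := hfirst
  -- The right side of the chain equation is `-2 S₁ g`, as the component along `b n₀` is
  -- annihilated. `S₁` sends the sector `η²` to `η⁴ = η`. A failure of injectivity there gives a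
  -- null vector `M g₁`; were it a multiple of `f₀`, comparison off `n₀` would put `g₁` in both
  -- sectors.
  by_cases hinj : ∀ x ∈ sec η, x - (W * S) x = 0 → x = 0
  · have hmem : -(2 : ℂ) • S₁ g ∈ sec η := by
      refine (sec η).smul_mem _ ?_
      rw [hsec] at hg ⊢
      rw [hRS₁, hg, map_smul, smul_smul]
      congr 1
      linear_combination η * hη3
    obtain ⟨g₁, hg₁, hgeq⟩ := exists_sub_eq_of_invariant hK (sec η) (hsec_closed _)
      (hsec_inv _) hinj hmem
    refine ⟨c • b n₀ + M g, M g₁, hf₀, hAf₀, Or.inl ?_⟩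
    rw [hAM g₁ (hsec_n₀ _ hη1 g₁ hg₁), hgeq, map_add T, map_smul T, hTb, smul_smul, map_add, map_smul,
      hab, smul_zero, zero_add, haTM]
  · push Not at hinj
    obtain ⟨g₁, hg₁, hg0, hgne⟩ := hinj
    refine ⟨c • b n₀ + M g, M g₁, hf₀, hAf₀, Or.inr ⟨?_, fun c' h => hgne ?_⟩⟩
    · rw [hAM g₁ (hsec_n₀ _ hη1 g₁ hg₁), hg0]
    · have h1 : g₁ - c' • g = 0 := by
        refine hMinj _ ?_ fun n hn => ?_
        · rw [hsub, hsmul, hsec_n₀ _ hη1 g₁ hg₁, hsec_n₀ _ hη2 g hg, mul_zero, sub_zero]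
        · rw [map_sub M, map_smul M, hsub, ← h, hsmul, hsmul, hadd, hsmul, hbn n hn]
          ring
      rw [sub_eq_zero] at h1
      rw [hsec] at hg₁
      have hg₁' : R g₁ = η ^ 2 • g₁ := by
        rw [hsec] at hg
        rw [h1, map_smul, hg, smul_comm]
      rw [hg₁, ← sub_eq_zero, ← sub_smul, smul_eq_zero] at hg₁'
      exact hg₁'.resolve_left (sub_ne_zero.mpr hηη)

end Sectors

/-! ### Coordinates, characters and the Fourier basis of the torus -/

section Torus

open Filter Topology

/-- The Fourier basis of `L²(ℂ/Λ)`. -/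
def fourierBasis : HilbertBasis (Fin 2 → ℤ) ℂ L2 := UnitAddTorus.mFourierBasis

lemma coeFn_fourierBasis (n : Fin 2 → ℤ) :
    fourierBasis n =ᵐ[torusMeasure] UnitAddTorus.mFourier n := by
  have h := UnitAddTorus.coeFn_mFourierLp (d := Fin 2) 2 n
  rw [← UnitAddTorus.coe_mFourierBasis] at h
  exact h

lemma fourierBasis_repr (f : L2) (n : Fin 2 → ℤ) :
    fourierBasis.repr f n = ∫ x, f x * UnitAddTorus.mFourier (-n) x ∂torusMeasure := by
  have h : fourierBasis.repr f n = ∫ x, UnitAddTorus.mFourier (-n) x • f x ∂torusMeasure :=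
    UnitAddTorus.mFourierBasis_repr f n
  rw [h]
  simp only [smul_eq_mul, mul_comm]

/-- The first coordinate of `z = sω + t`. -/
def coordS (z : ℂ) : ℝ := 2 * z.im / Real.sqrt 3

/-- The second coordinate of `z = sω + t`. -/
def coordT (z : ℂ) : ℝ := z.re + z.im / Real.sqrt 3

lemma om_eq : om = -1 / 2 + (Real.sqrt 3 / 2 : ℝ) * I := by
  have h1 : (2 * Real.pi * I / 3 : ℂ) = ((2 * Real.pi / 3 : ℝ) : ℂ) * I := by
    push_cast
    ring
  have h2 : (2 * Real.pi / 3 : ℝ) = Real.pi - Real.pi / 3 := by ring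
  rw [om, h1, Complex.exp_mul_I, ← Complex.ofReal_cos, ← Complex.ofReal_sin, h2, Real.cos_pi_sub,
    Real.sin_pi_sub, Real.cos_pi_div_three, Real.sin_pi_div_three]
  push_cast
  ring

lemma om_re : om.re = -1 / 2 := by
  rw [om_eq]
  simp

lemma om_im : om.im = Real.sqrt 3 / 2 := by
  rw [om_eq]
  simp

lemma om_sq : om ^ 2 = -1 - om := by
  have h3 : ((Real.sqrt 3 : ℝ) : ℂ) ^ 2 = 3 := by
    rw [← Complex.ofReal_pow, Real.sq_sqrt (by norm_num)]
    norm_num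
  rw [om_eq]
  push_cast
  linear_combination (1 / 4 * ((Real.sqrt 3 : ℝ) : ℂ) ^ 2) * I_sq - 1 / 4 * h3

lemma om_cube : om ^ 3 = 1 := by
  linear_combination (om - 1) * om_sq

lemma om_ne_one : om ≠ 1 := by
  intro h
  have := congrArg Complex.re h
  rw [om_re] at this
  norm_num at this

lemma conj_om : (starRingEnd ℂ) om = om ^ 2 := by
  rw [om_sq]
  apply Complex.ext
  · simp [om_re]
    norm_num
  · simp [om_im]

lemma coordS_add (z w : ℂ) : coordS (z + w) = coordS z + coordS w := by
  simp only [coordS, add_im]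
  ring

lemma coordT_add (z w : ℂ) : coordT (z + w) = coordT z + coordT w := by
  simp only [coordT, add_im, add_re]
  ring

lemma coordS_om (s t : ℝ) : coordS (om * s + t) = s := by
  have h3 : Real.sqrt 3 ≠ 0 := by positivity
  simp only [coordS, add_im, mul_im, om_im, om_re, ofReal_re, ofReal_im]
  field_simp
  ring

lemma coordT_om (s t : ℝ) : coordT (om * s + t) = t := by
  have h3 : Real.sqrt 3 ≠ 0 := by positivity
  simp only [coordT, add_im, add_re, mul_im, mul_re, om_im, om_re, ofReal_re, ofReal_im]
  field_simp
  ring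

lemma om_coord (z : ℂ) : om * coordS z + coordT z = z := by
  have h3 : Real.sqrt 3 ≠ 0 := by positivity
  apply Complex.ext
  · simp only [coordS, coordT, add_re, mul_re, om_im, om_re, ofReal_re, ofReal_im]
    field_simp
    ring
  · simp only [coordS, coordT, add_im, mul_im, om_im, om_re, ofReal_re, ofReal_im]
    field_simp
    ring

/-- The class of a complex number in `ℂ/Λ`. -/
def toTorus (z : ℂ) : Torus := ![(coordS z : UnitAddCircle), (coordT z : UnitAddCircle)]

lemma toTorus_add (z w : ℂ) : toTorus (z + w) = toTorus z + toTorus w := by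
  funext i
  fin_cases i
  · simp [toTorus, coordS_add]
  · simp [toTorus, coordT_add]

lemma toTorus_rep (x : Torus) : toTorus (rep x) = x := by
  have h := (UnitAddTorus.measurableEquivPiIoc (0 : Fin 2 → ℝ)).symm_apply_apply x
  funext i
  have hi := congrFun h i
  rw [UnitAddTorus.coe_symm_measurableEquivPiIoc_apply] at hi
  fin_cases i
  · exact (congrArg _ (coordS_om _ _)).trans hi
  · exact (congrArg _ (coordT_om _ _)).trans hi

lemma sub_mem_lattice_of_toTorus_eq {z w : ℂ} (h : toTorus z = toTorus w) : z - w ∈ lattice := by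
  have h0 : ((coordS z : ℝ) : UnitAddCircle) = coordS w := congrFun h 0
  have h1 : ((coordT z : ℝ) : UnitAddCircle) = coordT w := congrFun h 1
  rw [← sub_eq_zero, ← AddCircle.coe_sub, AddCircle.coe_eq_zero_iff] at h0 h1
  obtain ⟨a, ha⟩ := h0
  obtain ⟨b, hb⟩ := h1
  refine ⟨a, b, ?_⟩
  have ha' : ((coordS z - coordS w : ℝ) : ℂ) = a := by
    rw [← ha]
    simp
  have hb' : ((coordT z - coordT w : ℝ) : ℂ) = b := by
    rw [← hb]
    simp
  rw [← ha', ← hb']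
  nth_rewrite 1 [← om_coord z, ← om_coord w]
  push_cast
  ring

/-- A periodic function takes the same value at any two representatives of a point of the torus. -/
lemma LatticePeriodic.eq_of_toTorus_eq {f : ℂ → ℂ} (hf : LatticePeriodic f) {z w : ℂ}
    (h : toTorus z = toTorus w) : f z = f w := by
  have := hf _ (sub_mem_lattice_of_toTorus_eq h) w
  rwa [add_sub_cancel] at this

lemma toTorus_lattice {γ : ℂ} (hγ : γ ∈ lattice) : toTorus γ = 0 := by
  obtain ⟨a, b, rfl⟩ := hγ
  have h : (om * a + b : ℂ) = om * ((a : ℝ) : ℂ) + ((b : ℝ) : ℂ) := by push_cast; rfl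
  rw [h]
  funext i
  fin_cases i
  · change ((coordS _ : ℝ) : UnitAddCircle) = 0
    rw [coordS_om, AddCircle.coe_eq_zero_iff]
    exact ⟨a, by simp⟩
  · change ((coordT _ : ℝ) : UnitAddCircle) = 0
    rw [coordT_om, AddCircle.coe_eq_zero_iff]
    exact ⟨b, by simp⟩

/-- The exponential functions on `ℂ/Λ`, as functions on `ℂ`. -/
def wave (n : Fin 2 → ℤ) (z : ℂ) : ℂ := cexp (2 * Real.pi * I * (n 0 * coordS z + n 1 * coordT z))

lemma wave_eq_mFourier (n : Fin 2 → ℤ) (z : ℂ) :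
    wave n z = UnitAddTorus.mFourier n (toTorus z) := by
  simp only [UnitAddTorus.mFourier, ContinuousMap.coe_mk, Fin.prod_univ_two, toTorus,
    Matrix.cons_val_zero, Matrix.cons_val_one, fourier_coe_apply, ← Complex.exp_add]
  rw [wave]
  congr 1
  push_cast
  ring

lemma wave_rep (n : Fin 2 → ℤ) (x : Torus) : wave n (rep x) = UnitAddTorus.mFourier n x := by
  rw [wave_eq_mFourier, toTorus_rep]

lemma latticePeriodic_wave (n : Fin 2 → ℤ) : LatticePeriodic (wave n) := fun γ hγ z => by
  rw [wave_eq_mFourier, wave_eq_mFourier, toTorus_add, toTorus_lattice hγ, add_zero]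

/-- The symbol of `∂_{x₁}`. -/
def symX (n : Fin 2 → ℤ) : ℂ := 2 * Real.pi * I * n 1

/-- The symbol of `∂_{x₂}`. -/
def symY (n : Fin 2 → ℤ) : ℂ := 2 * Real.pi * I * ((2 * n 0 + n 1) / (Real.sqrt 3 : ℝ))

lemma wave_eq_exp (n : Fin 2 → ℤ) :
    wave n = fun z => cexp (symX n * (reCLM z : ℝ) + symY n * (imCLM z : ℝ)) := by
  funext z
  rw [wave]
  congr 1
  simp only [coordS, coordT, symX, symY, reCLM_apply, imCLM_apply]
  push_cast
  ring

lemma contDiff_wave (n : Fin 2 → ℤ) : ContDiff ℝ ∞ (wave n) := by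
  rw [wave_eq_exp]
  have h1 : ContDiff ℝ ∞ fun z : ℂ => ((reCLM z : ℝ) : ℂ) := (ofRealCLM.comp reCLM).contDiff
  have h2 : ContDiff ℝ ∞ fun z : ℂ => ((imCLM z : ℝ) : ℂ) := (ofRealCLM.comp imCLM).contDiff
  exact ((contDiff_const.mul h1).add (contDiff_const.mul h2)).cexp

lemma fderiv_wave (n : Fin 2 → ℤ) (z v : ℂ) :
    fderiv ℝ (wave n) z v = (symX n * v.re + symY n * v.im) * wave n z := by
  have h1 : HasFDerivAt (fun z : ℂ => ((reCLM z : ℝ) : ℂ)) (ofRealCLM.comp reCLM) z :=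
    (ofRealCLM.comp reCLM).hasFDerivAt
  have h2 : HasFDerivAt (fun z : ℂ => ((imCLM z : ℝ) : ℂ)) (ofRealCLM.comp imCLM) z :=
    (ofRealCLM.comp imCLM).hasFDerivAt
  have h3 := ((h1.const_mul (symX n)).add (h2.const_mul (symY n))).cexp
  rw [wave_eq_exp]
  have h4 := h3.fderiv
  simp only [Pi.add_apply] at h4
  erw [h4]
  simp
  ring

lemma dx_wave (n : Fin 2 → ℤ) : dx (wave n) = fun z => symX n * wave n z := by
  funext z
  simp [dx, fderiv_wave]

lemma dy_wave (n : Fin 2 → ℤ) : dy (wave n) = fun z => symY n * wave n z := by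
  funext z
  simp [dy, fderiv_wave]

end Torus

/-! ### Weak derivatives as Fourier multipliers -/

section WeakDerivatives

open Filter Topology

lemma integrable_comp_rep {g : ℂ → ℂ} (hg : Continuous g) :
    Integrable (fun x => g (rep x)) torusMeasure :=
  (memLp_comp_rep hg).integrable le_top

lemma LatticePeriodic.fderiv_apply {φ : ℂ → ℂ} (hφ : LatticePeriodic φ) (v : ℂ) :
    LatticePeriodic fun z => fderiv ℝ φ z v := by
  intro γ hγ z
  have h : (fun w => φ (w + γ)) = φ := funext (hφ γ hγ)
  simp only
  rw [← fderiv_comp_add_right, h]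

/-- The integral of a directional derivative over the torus vanishes. -/
lemma integral_fderiv_rep {φ : ℂ → ℂ} (hφ : ContDiff ℝ ∞ φ) (hper : LatticePeriodic φ) (v : ℂ) :
    ∫ x, fderiv ℝ φ (rep x) v ∂torusMeasure = 0 := by
  -- Haar measure is translation invariant, so the mean of a translate of `φ` does not depend on
  -- `t`; the integral in question is its derivative at `t = 0`.
  have hconst : ∀ t : ℝ, ∫ x, φ (rep x + t * v) ∂torusMeasure = ∫ x, φ (rep x) ∂torusMeasure := by
    intro t
    have h1 : ∀ x, φ (rep x + t * v) = φ (rep (x + toTorus (t * v))) := fun x => by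
      refine hper.eq_of_toTorus_eq ?_
      rw [toTorus_add, toTorus_rep, toTorus_rep]
    simp only [h1]
    exact integral_add_right_eq_self (μ := torusMeasure) (fun x => φ (rep x)) (toTorus (t * v))
  have hd : ∀ z, DifferentiableAt ℝ φ z := fun z => hφ.contDiffAt.differentiableAt (by simp)
  have hc : Continuous fun z => fderiv ℝ φ z v :=
    ((hφ.fderiv_right (m := ∞) (by simp)).clm_apply contDiff_const).continuous
  -- The radius leaves room for translates by `t * v` with `|t| < 1`, so that a single constant
  -- dominates.
  obtain ⟨C, hC⟩ := (isCompact_closedBall (0 : ℂ) (‖om‖ + 1 + ‖v‖)).exists_bound_of_continuousOn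
    hc.continuousOn
  have hder := hasDerivAt_integral_of_dominated_loc_of_deriv_le (μ := torusMeasure) (𝕜 := ℝ)
    (F := fun (t : ℝ) x => φ (rep x + t * v)) (F' := fun (t : ℝ) x => fderiv ℝ φ (rep x + t * v) v)
    (x₀ := 0) (s := Metric.ball 0 1) (bound := fun _ => C) (Metric.ball_mem_nhds 0 one_pos)
    (Eventually.of_forall fun t =>
      (integrable_comp_rep (g := fun z => φ (z + t * v))
        (hφ.continuous.comp (continuous_id.add continuous_const))).aestronglyMeasurable)
    (integrable_comp_rep (g := fun z => φ (z + (0 : ℝ) * v))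
        (hφ.continuous.comp (continuous_id.add continuous_const)))
    (integrable_comp_rep (g := fun z => fderiv ℝ φ (z + (0 : ℝ) * v) v)
        (hc.comp (continuous_id.add continuous_const))).aestronglyMeasurable
    (Eventually.of_forall fun x t ht => by
      refine hC _ ?_
      rw [mem_closedBall_zero_iff]
      refine (norm_add_le _ _).trans (add_le_add (norm_rep_le x) ?_)
      rw [norm_mul, Complex.norm_real]
      exact mul_le_of_le_one_left (norm_nonneg _) (mem_ball_zero_iff.mp ht).le)
    (integrable_const C)
    (Eventually.of_forall fun x t _ => by
      have h1 : HasDerivAt (fun t : ℝ => rep x + t * v) v t := by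
        have := ((Complex.ofRealCLM.hasDerivAt (x := t)).mul_const v).const_add (rep x)
        simpa using this
      exact (hd _).hasFDerivAt.comp_hasDerivAt t h1)
  have h0 := hder.2
  simp only [hconst] at h0
  have := h0.unique (hasDerivAt_const (0 : ℝ) _)
  simpa using this

lemma contDiff_fderiv_apply {φ : ℂ → ℂ} (hφ : ContDiff ℝ ∞ φ) (v : ℂ) :
    ContDiff ℝ ∞ fun z => fderiv ℝ φ z v :=
  (hφ.fderiv_right (m := ∞) (by simp)).clm_apply contDiff_const

/-- Integration by parts against an exponential function. -/
lemma integral_wave_mul_fderiv {φ : ℂ → ℂ} (hφ : ContDiff ℝ ∞ φ) (hper : LatticePeriodic φ)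
    (n : Fin 2 → ℤ) (v : ℂ) :
    ∫ x, wave n (rep x) * fderiv ℝ φ (rep x) v ∂torusMeasure =
      -(symX n * v.re + symY n * v.im) * ∫ x, wave n (rep x) * φ (rep x) ∂torusMeasure := by
  have h := integral_fderiv_rep (φ := fun z => wave n z * φ z) ((contDiff_wave n).mul hφ)
    (fun γ hγ z => by simp only [latticePeriodic_wave n γ hγ z, hper γ hγ z]) v
  have hd : ∀ {g : ℂ → ℂ}, ContDiff ℝ ∞ g → ∀ z, DifferentiableAt ℝ g z :=
    fun hg z => hg.contDiffAt.differentiableAt (by simp)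
  have h1 : ∀ x, fderiv ℝ (fun z => wave n z * φ z) (rep x) v = wave n (rep x) * fderiv ℝ φ (rep x) v +
      (symX n * v.re + symY n * v.im) * (wave n (rep x) * φ (rep x)) := by
    intro x
    rw [fderiv_fun_mul (hd (contDiff_wave n) _) (hd hφ _)]
    simp only [add_apply, smul_apply, smul_eq_mul, fderiv_wave]
    ring
  simp only [h1] at h
  have i1 := integrable_comp_rep (g := fun z => wave n z * fderiv ℝ φ z v)
    ((contDiff_wave n).continuous.mul (contDiff_fderiv_apply hφ v).continuous)
  have i2 := integrable_comp_rep (g := fun z => wave n z * φ z)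
    ((contDiff_wave n).continuous.mul hφ.continuous)
  rw [integral_add i1 (i2.const_mul _), integral_const_mul] at h
  linear_combination h

/-- The symbol of `∂^β`. -/
def sym (β : MultiIndex) (n : Fin 2 → ℤ) : ℂ := symX n ^ (β.1.1 : ℕ) * symY n ^ (β.1.2 : ℕ)

lemma iterate_dx_smul_wave (n : Fin 2 → ℤ) (j : ℕ) (c : ℂ) :
    dx^[j] (fun z => c * wave n z) = fun z => symX n ^ j * c * wave n z := by
  induction j with
  | zero => simp
  | succ j ih =>
    rw [Function.iterate_succ_apply', ih]
    funext z
    have hd : DifferentiableAt ℝ (wave n) z :=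
      (contDiff_wave n).contDiffAt.differentiableAt (by simp)
    have h : dx (wave n) z = symX n * wave n z := congrFun (dx_wave n) z
    rw [dx] at h ⊢
    rw [fderiv_const_mul hd, smul_apply, h, smul_eq_mul]
    ring

lemma iterate_dy_wave (n : Fin 2 → ℤ) (j : ℕ) :
    dy^[j] (wave n) = fun z => symY n ^ j * wave n z := by
  induction j with
  | zero => simp
  | succ j ih =>
    rw [Function.iterate_succ_apply', ih]
    funext z
    have hd : DifferentiableAt ℝ (wave n) z :=
      (contDiff_wave n).contDiffAt.differentiableAt (by simp)
    have h : dy (wave n) z = symY n * wave n z := congrFun (dy_wave n) z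
    rw [dy] at h ⊢
    rw [fderiv_const_mul hd, smul_apply, h, smul_eq_mul]
    ring

lemma partialD_wave (β : MultiIndex) (n : Fin 2 → ℤ) :
    partialD β (wave n) = fun z => sym β n * wave n z := by
  rw [partialD, iterate_dy_wave, iterate_dx_smul_wave]
  rfl

lemma integral_wave_mul_partialD (β : MultiIndex) {φ : ℂ → ℂ} (hφ : ContDiff ℝ ∞ φ)
    (hper : LatticePeriodic φ) (n : Fin 2 → ℤ) :
    ∫ x, wave n (rep x) * partialD β φ (rep x) ∂torusMeasure =
      (-1) ^ ((β.1.1 : ℕ) + (β.1.2 : ℕ)) * sym β n *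
        ∫ x, wave n (rep x) * φ (rep x) ∂torusMeasure := by
  have hx : ∀ j : ℕ, ∀ ψ : ℂ → ℂ, ContDiff ℝ ∞ ψ → LatticePeriodic ψ →
      ∫ x, wave n (rep x) * dx^[j] ψ (rep x) ∂torusMeasure =
        (-symX n) ^ j * ∫ x, wave n (rep x) * ψ (rep x) ∂torusMeasure := by
    intro j
    induction j with
    | zero => simp
    | succ j ih =>
      intro ψ hψ hψp
      rw [Function.iterate_succ_apply, ih (dx ψ) (contDiff_fderiv_apply hψ 1) (hψp.fderiv_apply 1)]
      have := integral_wave_mul_fderiv hψ hψp n 1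
      rw [one_re, one_im] at this
      change (-symX n) ^ j * ∫ x, wave n (rep x) * fderiv ℝ ψ (rep x) 1 ∂torusMeasure = _
      rw [this]
      push_cast
      ring
  have hy : ∀ j : ℕ, ∀ ψ : ℂ → ℂ, ContDiff ℝ ∞ ψ → LatticePeriodic ψ →
      ContDiff ℝ ∞ (dy^[j] ψ) ∧ LatticePeriodic (dy^[j] ψ) ∧
      ∫ x, wave n (rep x) * dy^[j] ψ (rep x) ∂torusMeasure =
        (-symY n) ^ j * ∫ x, wave n (rep x) * ψ (rep x) ∂torusMeasure := by
    intro j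
    induction j with
    | zero => simp +contextual
    | succ j ih =>
      intro ψ hψ hψp
      rw [Function.iterate_succ_apply]
      obtain ⟨h1, h2, h3⟩ := ih (dy ψ) (contDiff_fderiv_apply hψ I) (hψp.fderiv_apply I)
      refine ⟨h1, h2, h3.trans ?_⟩
      have := integral_wave_mul_fderiv hψ hψp n I
      rw [I_re, I_im] at this
      change (-symY n) ^ j * ∫ x, wave n (rep x) * fderiv ℝ ψ (rep x) I ∂torusMeasure = _
      rw [this]
      push_cast
      ring
  obtain ⟨h1, h2, h3⟩ := hy β.1.2 φ hφ hper
  rw [partialD, hx _ _ h1 h2, h3, sym, neg_pow, neg_pow (symY n), pow_add]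
  ring

lemma sym_neg (β : MultiIndex) (n : Fin 2 → ℤ) :
    sym β (-n) = (-1) ^ ((β.1.1 : ℕ) + (β.1.2 : ℕ)) * sym β n := by
  have h1 : symX (-n) = -symX n := by simp [symX]
  have h2 : symY (-n) = -symY n := by
    simp only [symY, Pi.neg_apply]
    push_cast
    ring
  rw [sym, sym, h1, h2, neg_pow, neg_pow (symY n), pow_add]
  ring

/-- The test function is the exponential of index `-n`; the sign in its symbol cancels the sign of
integration by parts. -/
lemma repr_of_isWeakDeriv {β : MultiIndex} {u v : L2} (h : IsWeakDeriv β u v) (n : Fin 2 → ℤ) :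
    fourierBasis.repr v n = sym β n * fourierBasis.repr u n := by
  have h1 := h (wave (-n)) (contDiff_wave _) (latticePeriodic_wave _)
  simp only [partialD_wave, wave_rep, ← mul_assoc] at h1
  rw [fourierBasis_repr, fourierBasis_repr, h1]
  have h2 : ∀ x : Torus, u x * sym β (-n) * UnitAddTorus.mFourier (-n) x =
      sym β (-n) * (u x * UnitAddTorus.mFourier (-n) x) := fun x => by ring
  simp only [h2]
  rw [integral_const_mul, ← mul_assoc, sym_neg, ← mul_assoc, ← mul_pow]
  simp

/-- Pairing with a test function is continuous on `L²`, so the identity may be checked term by term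
on Fourier series, where it is integration by parts against exponentials. -/
lemma isWeakDeriv_of_repr {β : MultiIndex} {u v : L2}
    (h : ∀ n, fourierBasis.repr v n = sym β n * fourierBasis.repr u n) : IsWeakDeriv β u v := by
  intro φ hφ hper
  obtain ⟨L, hL⟩ := exists_pairing hφ.continuous
  obtain ⟨M, hM⟩ := exists_pairing (contDiff_partialD β hφ).continuous
  have hb : ∀ (n : Fin 2 → ℤ) (g : ℂ → ℂ),
      ∫ x, fourierBasis n x * g (rep x) ∂torusMeasure =
        ∫ x, wave n (rep x) * g (rep x) ∂torusMeasure := fun n g => by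
    refine integral_congr_ae ?_
    filter_upwards [coeFn_fourierBasis n] with x hx
    rw [hx, wave_rep]
  rw [← hL, ← hM]
  have h1 := L.hasSum (fourierBasis.hasSum_repr v)
  have h2 := (M.hasSum (fourierBasis.hasSum_repr u)).mul_left
    ((-1) ^ ((β.1.1 : ℕ) + (β.1.2 : ℕ)))
  have heq : (fun n => L (fourierBasis.repr v n • fourierBasis n)) = fun n =>
      (-1) ^ ((β.1.1 : ℕ) + (β.1.2 : ℕ)) * M (fourierBasis.repr u n • fourierBasis n) := by
    funext n
    rw [map_smul, map_smul, hL, hM, hb, hb, integral_wave_mul_partialD β hφ hper, h, smul_eq_mul,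
      smul_eq_mul]
    have : ((-1 : ℂ) ^ ((β.1.1 : ℕ) + (β.1.2 : ℕ))) * (-1) ^ ((β.1.1 : ℕ) + (β.1.2 : ℕ)) = 1 := by
      rw [← mul_pow]
      simp
    linear_combination (-sym β n * fourierBasis.repr u n *
      ∫ x, wave n (rep x) * φ (rep x) ∂torusMeasure) * this
  rw [heq] at h1
  exact h1.unique h2

end WeakDerivatives

/-! ### The spectrum of `2D_{z̄}` and its rotation -/

section Frequencies

open Filter Topology

/-- The symbol of `2D_{z̄}`. -/
def freq (n : Fin 2 → ℤ) : ℂ := 1 / I * (symX n + I * symY n)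

lemma freq_eq (n : Fin 2 → ℤ) : freq n = ((2 * Real.pi * n 1 : ℝ) : ℂ) +
    ((2 * Real.pi * ((2 * n 0 + n 1) / Real.sqrt 3) : ℝ) : ℂ) * I := by
  simp only [freq, symX, symY, one_div, inv_I]
  push_cast
  linear_combination (-2 * Real.pi * n 1 -
    2 * Real.pi * ((2 * n 0 + n 1) / (Real.sqrt 3 : ℝ)) * I) * I_sq

lemma freq_re (n : Fin 2 → ℤ) : (freq n).re = 2 * Real.pi * n 1 := by
  rw [freq_eq]
  simp

lemma freq_im (n : Fin 2 → ℤ) : (freq n).im = 2 * Real.pi * ((2 * n 0 + n 1) / Real.sqrt 3) := by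
  rw [freq_eq]
  simp

lemma symX_eq (n : Fin 2 → ℤ) : symX n = I * (freq n).re := by
  rw [freq_re, symX]
  push_cast
  ring

lemma symY_eq (n : Fin 2 → ℤ) : symY n = I * (freq n).im := by
  rw [freq_im, symY]
  push_cast
  ring

lemma norm_symX_le (n : Fin 2 → ℤ) : ‖symX n‖ ≤ ‖freq n‖ := by
  rw [symX_eq, norm_mul, norm_I, one_mul, norm_real]
  exact abs_re_le_norm _

lemma norm_symY_le (n : Fin 2 → ℤ) : ‖symY n‖ ≤ ‖freq n‖ := by
  rw [symY_eq, norm_mul, norm_I, one_mul, norm_real]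
  exact abs_im_le_norm _

lemma freq_add (m n : Fin 2 → ℤ) : freq (m + n) = freq m + freq n := by
  simp only [freq, symX, symY, Pi.add_apply]
  push_cast
  ring

lemma freq_injective : Function.Injective freq := by
  intro m n h
  have hpi : (2 * Real.pi : ℝ) ≠ 0 := by positivity
  have h3 : Real.sqrt 3 ≠ 0 := by positivity
  have h1 := congrArg re h
  have h2 := congrArg im h
  rw [freq_re, freq_re] at h1
  rw [freq_im, freq_im] at h2
  have e1 := mul_left_cancel₀ hpi h1
  have e2 := mul_left_cancel₀ hpi h2
  rw [div_left_inj' h3] at e2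
  have e1' : m 1 = n 1 := by exact_mod_cast e1
  have e2' : 2 * m 0 + m 1 = 2 * n 0 + n 1 := by exact_mod_cast e2
  funext i
  fin_cases i
  · change m 0 = n 0
    omega
  · exact e1'

/-- The integers `n 1` and `2 * n 0 + n 1` are both bounded by `‖freq n‖` and determine `n`. -/
lemma tendsto_norm_freq : Tendsto (fun n => ‖freq n‖) cofinite atTop := by
  rw [tendsto_atTop]
  intro r
  rw [eventually_cofinite]
  set N : ℤ := ⌈r⌉
  refine (Set.finite_Icc (fun _ : Fin 2 => -N) (fun _ => N)).subset fun n hn => ?_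
  have hn : ‖freq n‖ < r := not_le.mp hn
  have h1 : |(n 1 : ℝ)| ≤ ‖freq n‖ := by
    refine le_trans ?_ (abs_re_le_norm _)
    rw [freq_re, abs_mul, abs_of_pos (by positivity : (0 : ℝ) < 2 * Real.pi)]
    exact le_mul_of_one_le_left (abs_nonneg _) (by linarith [Real.pi_gt_three])
  have h2 : |(2 * n 0 + n 1 : ℝ)| ≤ ‖freq n‖ := by
    refine le_trans ?_ (abs_im_le_norm _)
    have h3 : Real.sqrt 3 ≤ 2 * Real.pi := by
      rw [Real.sqrt_le_left (by positivity)]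
      nlinarith [Real.pi_gt_three]
    have h4 : 0 < Real.sqrt 3 := by positivity
    rw [freq_im, abs_mul, abs_of_pos (by positivity : (0 : ℝ) < 2 * Real.pi), abs_div,
      abs_of_pos h4, mul_div_assoc', le_div_iff₀ h4, mul_comm]
    exact mul_le_mul_of_nonneg_right h3 (abs_nonneg _)
  have hN : r ≤ N := Int.le_ceil r
  have h1' := abs_lt.mp (h1.trans_lt (hn.trans_le hN))
  have h2' := abs_lt.mp (h2.trans_lt (hn.trans_le hN))
  have a1 : -N < n 1 := by exact_mod_cast h1'.1
  have a2 : n 1 < N := by exact_mod_cast h1'.2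
  have a3 : -N < 2 * n 0 + n 1 := by exact_mod_cast h2'.1
  have a4 : 2 * n 0 + n 1 < N := by exact_mod_cast h2'.2
  constructor
  · intro i
    fin_cases i
    · change -N ≤ n 0
      omega
    · exact a1.le
  · intro i
    fin_cases i
    · change n 0 ≤ N
      omega
    · exact a2.le

lemma tendsto_norm_freq_add (k : ℂ) : Tendsto (fun n => ‖freq n + k‖) cofinite atTop := by
  refine tendsto_atTop_mono (fun n => ?_)
    (tendsto_atTop_add_const_right cofinite (-‖k‖) tendsto_norm_freq)
  have := norm_sub_norm_le (freq n) (-k)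
  rw [norm_neg, sub_neg_eq_add] at this
  exact this

/-- Frequencies have real part in `2πℤ`; this is why `π` can serve as the base point of the
resolvent. -/
lemma freq_add_pi_ne_zero (n : Fin 2 → ℤ) : freq n + Real.pi ≠ 0 := by
  intro h
  have h1 := congrArg re h
  rw [add_re, freq_re, ofReal_re, zero_re] at h1
  have h2 : (2 * n 1 + 1 : ℝ) = 0 := by
    have : Real.pi * (2 * n 1 + 1) = 0 := by linear_combination h1
    exact (mul_eq_zero.mp this).resolve_left Real.pi_ne_zero
  have h3 : 2 * n 1 + 1 = 0 := by exact_mod_cast h2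
  omega

lemma exists_freq_eq {k : ℂ} (hk : k ∈ dualLattice) : ∃ m, freq m = k := by
  obtain ⟨_, ⟨a, b, rfl⟩, rfl⟩ := hk
  have h3 : ((Real.sqrt 3 : ℝ) : ℂ) ≠ 0 := by
    rw [Ne, ofReal_eq_zero]
    positivity
  have h3' : ((Real.sqrt 3 : ℝ) : ℂ) ^ 2 = 3 := by
    rw [← ofReal_pow, Real.sq_sqrt (by norm_num)]
    norm_num
  -- The point `(4πi/√3)(aω + b)` has real part `-2πa` and imaginary part `2π(2b - a)/√3`.
  refine ⟨![b, -a], ?_⟩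
  rw [om_eq]
  simp only [freq, symX, symY, one_div, inv_I, Matrix.cons_val_zero, Matrix.cons_val_one]
  push_cast
  field_simp
  linear_combination (4 * a - 8 * b) * I_sq

/-- The action of the rotation on the indices of the Fourier basis. -/
def rotIndex : (Fin 2 → ℤ) ≃+ (Fin 2 → ℤ) where
  toFun n := ![-n 0 - n 1, n 0]
  invFun n := ![n 1, -n 0 - n 1]
  left_inv n := by
    funext i
    fin_cases i <;> simp
  right_inv n := by
    funext i
    fin_cases i
    · simp
      ring
    · simp
  map_add' m n := by
    funext i
    fin_cases i
    · simp
      ring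
    · simp

/-- The exponential of index `n` is `exp (i Re (conj (freq n) z))`, so replacing `z` by `ωz`
multiplies its frequency by `ω̄ = ω²`. -/
lemma freq_rotIndex (n : Fin 2 → ℤ) : freq (rotIndex n) = om ^ 2 * freq n := by
  have h3 : Real.sqrt 3 ≠ 0 := by positivity
  have h3' : Real.sqrt 3 ^ 2 = 3 := Real.sq_sqrt (by norm_num)
  rw [om_sq]
  have e0 : rotIndex n 0 = -n 0 - n 1 := rfl
  have e1 : rotIndex n 1 = n 0 := rfl
  apply Complex.ext
  · rw [mul_re, freq_re, freq_re, freq_im, e1]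
    simp only [sub_re, neg_re, one_re, sub_im, neg_im, one_im, om_re, om_im]
    field_simp
    ring
  · rw [mul_im, freq_re, freq_im, freq_im, e0, e1]
    simp only [sub_re, neg_re, one_re, sub_im, neg_im, one_im, om_re, om_im]
    push_cast
    field_simp
    linear_combination (n 1 : ℝ) * h3'

end Frequencies

/-! ### Conjugation of `Q(α, ζ)` to a quadratic pencil on `L²` -/

section Conjugation

open Filter Topology

lemma repr_weakD (β : MultiIndex) (f : H2) (n : Fin 2 → ℤ) :
    fourierBasis.repr (weakD β f) n = sym β n * fourierBasis.repr (incl f) n :=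
  repr_of_isWeakDeriv (f.2 β) n

lemma repr_twoDbar (f : H2) (n : Fin 2 → ℤ) :
    fourierBasis.repr (twoDbar f) n = freq n * fourierBasis.repr (incl f) n := by
  simp only [twoDbar, smul_apply, add_apply, map_smul, map_add, lp.coeFn_smul, lp.coeFn_add,
    Pi.smul_apply, Pi.add_apply, smul_eq_mul, repr_weakD, sym, freq]
  norm_num
  ring

lemma repr_twoDbarSq (f : H2) (n : Fin 2 → ℤ) :
    fourierBasis.repr (twoDbarSq f) n = freq n ^ 2 * fourierBasis.repr (incl f) n := by
  simp only [twoDbarSq, smul_apply, add_apply, map_smul, map_add, lp.coeFn_smul, lp.coeFn_add,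
    Pi.smul_apply, Pi.add_apply, smul_eq_mul, repr_weakD, sym, freq, one_div, inv_I]
  norm_num
  linear_combination (-2 * symX n * symY n * I + symY n ^ 2 - symY n ^ 2 * I ^ 2 - symX n ^ 2) *
    fourierBasis.repr (incl f) n * I_sq

lemma bddSeq_inv_freq_add_pi : BddSeq fun n => (freq n + Real.pi)⁻¹ :=
  bddSeq_of_tendsto (tendsto_inv_of_tendsto_norm_atTop (tendsto_norm_freq_add _))

/-- The operator `(2D_{z̄} + π)⁻¹` on `L²(ℂ/Λ)`. -/
def resolventPi : L2 →L[ℂ] L2 := diagOp fourierBasis fun n => (freq n + Real.pi)⁻¹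

lemma repr_resolventPi (u : L2) (n : Fin 2 → ℤ) :
    fourierBasis.repr (resolventPi u) n = (freq n + Real.pi)⁻¹ * fourierBasis.repr u n :=
  repr_diagOp _ bddSeq_inv_freq_add_pi u n

lemma isCompactOperator_resolventPi : IsCompactOperator resolventPi :=
  isCompactOperator_diagOp _ (tendsto_inv_of_tendsto_norm_atTop (tendsto_norm_freq_add _))

/-- The operator `(2D_{z̄} + π)² : H²(ℂ/Λ) → L²(ℂ/Λ)`. -/
def dbarPiSq : H2 →L[ℂ] L2 :=
  twoDbarSq + (2 * (Real.pi : ℂ)) • twoDbar + (Real.pi : ℂ) ^ 2 • incl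

lemma repr_dbarPiSq (f : H2) (n : Fin 2 → ℤ) :
    fourierBasis.repr (dbarPiSq f) n = (freq n + Real.pi) ^ 2 * fourierBasis.repr (incl f) n := by
  simp only [dbarPiSq, smul_apply, add_apply, map_smul, map_add, lp.coeFn_smul, lp.coeFn_add,
    Pi.smul_apply, Pi.add_apply, smul_eq_mul, repr_twoDbar, repr_twoDbarSq]
  ring

lemma injective_dbarPiSq : Function.Injective dbarPiSq := by
  rw [injective_iff_map_eq_zero]
  intro f hf
  have h0 : ∀ n, fourierBasis.repr (incl f) n = 0 := fun n => by
    have h := repr_dbarPiSq f n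
    rw [hf, map_zero] at h
    exact (mul_eq_zero.mp h.symm).resolve_left (pow_ne_zero 2 (freq_add_pi_ne_zero n))
  have h1 : ∀ β, weakD β f = 0 := fun β => by
    refine hilbertBasis_ext fourierBasis fun n => ?_
    rw [repr_weakD, h0, mul_zero, map_zero]
    rfl
  apply Subtype.ext
  ext1 β
  exact h1 β

/-- A derivative of order at most two costs at most two powers of `‖freq n‖`, which two resolvent
factors compensate. This elliptic estimate is what puts solutions of `(2D_{z̄} + π)² f = g` in `H²`.
-/
lemma bddSeq_sym_mul (β : MultiIndex) :
    BddSeq fun n => sym β n * ((freq n + Real.pi)⁻¹) ^ 2 := by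
  obtain ⟨C, hC⟩ := bddSeq_inv_freq_add_pi
  have hC' : ∀ n, ‖(freq n + Real.pi)⁻¹‖ ≤ C := fun n => hC ⟨n, rfl⟩
  have hC0 : 0 ≤ C := (norm_nonneg _).trans (hC' 0)
  set D : ℝ := 1 + Real.pi * C + C with hD
  have hD1 : 1 ≤ D := by
    have : 0 ≤ Real.pi * C := by positivity
    linarith
  have hCD : C ≤ D := by
    have : 0 ≤ Real.pi * C := by positivity
    linarith
  have hfreq : ∀ n, ‖freq n‖ * ‖(freq n + Real.pi)⁻¹‖ ≤ D := fun n => by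
    have h : freq n * (freq n + Real.pi)⁻¹ = 1 - Real.pi * (freq n + Real.pi)⁻¹ := by
      have := freq_add_pi_ne_zero n
      field_simp
      ring
    rw [← norm_mul, h]
    refine (norm_sub_le _ _).trans ?_
    rw [norm_one, norm_mul, norm_real, Real.norm_of_nonneg Real.pi_pos.le]
    have := mul_le_mul_of_nonneg_left (hC' n) Real.pi_pos.le
    linarith
  refine bddSeq_of_le (C := D ^ 2) fun n => ?_
  have hβ := β.2
  -- The truncated subtraction is exact because the order of `β` is at most `2`.
  have hsplit : 2 = ((β.1.1 : ℕ) + (β.1.2 : ℕ)) + (2 - ((β.1.1 : ℕ) + (β.1.2 : ℕ))) := by omega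
  have h1 : ‖sym β n‖ ≤ ‖freq n‖ ^ ((β.1.1 : ℕ) + (β.1.2 : ℕ)) := by
    rw [sym, norm_mul, norm_pow, norm_pow, pow_add]
    gcongr
    · exact norm_symX_le n
    · exact norm_symY_le n
  rw [norm_mul, norm_pow]
  generalize (β.1.1 : ℕ) + (β.1.2 : ℕ) = j at *
  calc ‖sym β n‖ * ‖(freq n + Real.pi)⁻¹‖ ^ 2
      ≤ ‖freq n‖ ^ j * ‖(freq n + Real.pi)⁻¹‖ ^ 2 := by gcongr
    _ = (‖freq n‖ * ‖(freq n + Real.pi)⁻¹‖) ^ j * ‖(freq n + Real.pi)⁻¹‖ ^ (2 - j) := by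
        rw [mul_pow, mul_assoc, ← pow_add, ← hsplit]
    _ ≤ D ^ j * D ^ (2 - j) := by
        gcongr
        · exact hfreq n
        · exact (hC' n).trans hCD
    _ = D ^ 2 := by rw [← pow_add, ← hsplit]

lemma surjective_dbarPiSq : Function.Surjective dbarPiSq := by
  intro g
  -- The solution has coefficients `(freq n + π)⁻²` times those of `g`; its derivatives are entered
  -- as the corresponding multipliers.
  set F : PiLp 2 fun _ : MultiIndex => L2 := WithLp.toLp 2 fun β =>
    diagOp fourierBasis (fun n => sym β n * ((freq n + Real.pi)⁻¹) ^ 2) g with hF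
  have hrepr : ∀ β n, fourierBasis.repr (F β) n =
      sym β n * ((freq n + Real.pi)⁻¹) ^ 2 * fourierBasis.repr g n := fun β n =>
    repr_diagOp _ (bddSeq_sym_mul β) g n
  have h0 : ∀ n, fourierBasis.repr (F idx0) n =
      ((freq n + Real.pi)⁻¹) ^ 2 * fourierBasis.repr g n := fun n => by
    rw [hrepr]
    simp [sym, idx0]
  have hmem : F ∈ H2 := fun β => isWeakDeriv_of_repr fun n => by
    rw [hrepr, h0, mul_assoc]
  refine ⟨⟨F, hmem⟩, hilbertBasis_ext fourierBasis fun n => ?_⟩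
  rw [repr_dbarPiSq]
  change _ * fourierBasis.repr (F idx0) n = _
  rw [h0, ← mul_assoc, ← mul_pow, mul_inv_cancel₀ (freq_add_pi_ne_zero n), one_pow, one_mul]

/-- `(2D_{z̄} + π)²` as an isomorphism `H²(ℂ/Λ) ≃ L²(ℂ/Λ)`. -/
def dbarPiSqEquiv : H2 ≃L[ℂ] L2 :=
  ContinuousLinearEquiv.ofBijective dbarPiSq (LinearMap.ker_eq_bot.mpr injective_dbarPiSq)
    (LinearMap.range_eq_top.mpr surjective_dbarPiSq)

lemma repr_dbarPiSqEquiv (f : H2) (n : Fin 2 → ℤ) :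
    fourierBasis.repr (dbarPiSqEquiv f) n =
      (freq n + Real.pi) ^ 2 * fourierBasis.repr (incl f) n :=
  repr_dbarPiSq f n

/-- The pencil on `L²(ℂ/Λ)` that is conjugate to `Q(α, ·)`. -/
def torusPencil (V : Potential) (α ζ : ℂ) : L2 →L[ℂ] L2 :=
  quadPencil (1 - (Real.pi : ℂ) • resolventPi) resolventPi
    ((α ^ 2 • mulOp V.toFun V.smooth.continuous) * resolventPi * resolventPi) ζ

lemma resolventPi_resolventPi_dbarPiSqEquiv (f : H2) :
    resolventPi (resolventPi (dbarPiSqEquiv f)) = incl f := by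
  refine hilbertBasis_ext fourierBasis fun n => ?_
  have := freq_add_pi_ne_zero n
  rw [repr_resolventPi, repr_resolventPi, repr_dbarPiSqEquiv]
  field_simp

lemma repr_shift_resolventPi (ζ : ℂ) (u : L2) (n : Fin 2 → ℤ) :
    fourierBasis.repr ((1 - (Real.pi : ℂ) • resolventPi + ζ • resolventPi) u) n =
      (freq n + ζ) * (freq n + Real.pi)⁻¹ * fourierBasis.repr u n := by
  simp only [add_apply, sub_apply, smul_apply, one_apply_eq_self, map_add, map_sub, map_smul,
    lp.coeFn_add, lp.coeFn_sub, lp.coeFn_smul, Pi.add_apply, Pi.sub_apply, Pi.smul_apply,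
    smul_eq_mul, repr_resolventPi]
  have := freq_add_pi_ne_zero n
  field_simp
  ring

/-- With `T = (2D_{z̄} + π)⁻¹`, the operator `1 - πT + ζT` is `(2D_{z̄} + ζ)(2D_{z̄} + π)⁻¹`, and
`T² (2D_{z̄} + π)²` is the inclusion of `H²`. -/
lemma Q_eq_torusPencil_comp (V : Potential) (α ζ : ℂ) :
    Q V α ζ = torusPencil V α ζ ∘L (dbarPiSqEquiv : H2 →L[ℂ] L2) := by
  ext1 f
  have h1 : (1 - (Real.pi : ℂ) • resolventPi + ζ • resolventPi)
      ((1 - (Real.pi : ℂ) • resolventPi + ζ • resolventPi) (dbarPiSqEquiv f)) =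
      (twoDbarSq + (2 * ζ) • twoDbar + ζ ^ 2 • incl) f := by
    refine hilbertBasis_ext fourierBasis fun n => ?_
    rw [repr_shift_resolventPi, repr_shift_resolventPi, repr_dbarPiSqEquiv]
    simp only [smul_apply, add_apply, map_smul, map_add, lp.coeFn_smul, lp.coeFn_add,
      Pi.smul_apply, Pi.add_apply, smul_eq_mul, repr_twoDbar, repr_twoDbarSq]
    have := freq_add_pi_ne_zero n
    field_simp
    ring
  change (twoDbarSq + (2 * ζ) • twoDbar + ζ ^ 2 • incl) f -
    (α ^ 2 • (mulOp V.toFun V.smooth.continuous).comp incl) f =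
    (1 - (Real.pi : ℂ) • resolventPi + ζ • resolventPi)
      ((1 - (Real.pi : ℂ) • resolventPi + ζ • resolventPi) (dbarPiSqEquiv f)) -
      (α ^ 2 • mulOp V.toFun V.smooth.continuous)
        (resolventPi (resolventPi (dbarPiSqEquiv f)))
  rw [h1, resolventPi_resolventPi_dbarPiSqEquiv]
  rfl

lemma deriv_quadratic {F : Type*} [NormedAddCommGroup F] [NormedSpace ℂ F] (A B C D : F)
    (ζ : ℂ) : deriv (fun ξ : ℂ => A + (2 * ξ) • B + ξ ^ 2 • C - D) ζ =
      (2 : ℂ) • B + (2 * ζ) • C := by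
  have h1 : HasDerivAt (fun ξ : ℂ => (2 * ξ) • B) ((2 * 1 : ℂ) • B) ζ :=
    ((hasDerivAt_id ζ).const_mul 2).smul_const B
  have h2 : HasDerivAt (fun ξ : ℂ => (ξ ^ 2) • C) ((2 * ζ : ℂ) • C) ζ := by
    have := (hasDerivAt_pow 2 ζ).smul_const C
    simpa using this
  have h3 := ((h1.const_add A).add h2).sub_const D
  rw [mul_one] at h3
  exact h3.deriv

lemma deriv_Q (V : Potential) (α ζ : ℂ) :
    deriv (fun ξ => Q V α ξ) ζ =
      ((2 : ℂ) • (resolventPi * (1 - (Real.pi : ℂ) • resolventPi + ζ • resolventPi))) ∘L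
        (dbarPiSqEquiv : H2 →L[ℂ] L2) := by
  refine (deriv_quadratic twoDbarSq twoDbar incl
    (α ^ 2 • (mulOp V.toFun V.smooth.continuous).comp incl) ζ).trans ?_
  ext1 f
  refine hilbertBasis_ext fourierBasis fun n => ?_
  have h : fourierBasis.repr ((2 : ℂ) • resolventPi
      ((1 - (Real.pi : ℂ) • resolventPi + ζ • resolventPi) (dbarPiSqEquiv f))) n =
      2 * (freq n + ζ) * fourierBasis.repr (incl f) n := by
    rw [map_smul, lp.coeFn_smul, Pi.smul_apply, repr_resolventPi, repr_shift_resolventPi,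
      repr_dbarPiSqEquiv, smul_eq_mul]
    have := freq_add_pi_ne_zero n
    field_simp
  refine Eq.trans ?_ h.symm
  simp only [smul_apply, add_apply, map_smul, map_add, lp.coeFn_smul, lp.coeFn_add,
    Pi.smul_apply, Pi.add_apply, smul_eq_mul, repr_twoDbar]
  ring

lemma isInvertible_Q_iff (V : Potential) (α ζ : ℂ) :
    (Q V α ζ).IsInvertible ↔ IsUnit (torusPencil V α ζ) := by
  rw [Q_eq_torusPencil_comp, ContinuousLinearMap.isInvertible_comp_equiv]
  constructor
  · rintro ⟨e, he⟩
    rw [← he, ContinuousLinearMap.isUnit_iff_bijective]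
    exact e.bijective
  · intro h
    exact ⟨ContinuousLinearEquiv.unitsEquiv ℂ L2 h.unit, rfl⟩

lemma inverse_Q_comp_deriv (V : Potential) (α ζ : ℂ) :
    (Q V α ζ).inverse.comp (deriv (fun ξ => Q V α ξ) ζ) =
      (dbarPiSqEquiv.symm : L2 →L[ℂ] H2) ∘L (Ring.inverse (torusPencil V α ζ) *
        ((2 : ℂ) • (resolventPi * (1 - (Real.pi : ℂ) • resolventPi + ζ • resolventPi)))) ∘L
        (dbarPiSqEquiv : H2 →L[ℂ] L2) := by
  rw [deriv_Q, Q_eq_torusPencil_comp, ContinuousLinearMap.inverse_comp_equiv,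
    ContinuousLinearMap.ringInverse_eq_inverse]
  rfl

lemma continuous_torusPencil (V : Potential) (α : ℂ) : Continuous (torusPencil V α) := by
  unfold torusPencil quadPencil
  fun_prop

/-- The trace of a contour integral is invariant under conjugation by an isomorphism. -/
lemma finiteRankTrace_circleIntegral_conj {E F : Type*} [NormedAddCommGroup E] [NormedSpace ℂ E]
    [CompleteSpace E] [NormedAddCommGroup F] [NormedSpace ℂ F] [CompleteSpace F] (e : E ≃L[ℂ] F)
    {G : ℂ → F →L[ℂ] F} {c : ℂ} {r : ℝ} (hG : CircleIntegrable G c r)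
    [FiniteDimensional ℂ (LinearMap.range (∮ ζ in C(c, r), G ζ).toLinearMap)] :
    finiteRankTrace (∮ ζ in C(c, r), (e.symm : F →L[ℂ] E) ∘L G ζ ∘L (e : E →L[ℂ] F)).toLinearMap =
      finiteRankTrace (∮ ζ in C(c, r), G ζ).toLinearMap := by
  set L : (F →L[ℂ] F) →L[ℂ] (E →L[ℂ] E) :=
    (ContinuousLinearMap.compL ℂ E F E (e.symm : F →L[ℂ] E)) ∘L
      ((ContinuousLinearMap.compL ℂ E F F).flip (e : E →L[ℂ] F)) with hL
  have hpull : (∮ ζ in C(c, r), (e.symm : F →L[ℂ] E) ∘L G ζ ∘L (e : E →L[ℂ] F)) =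
      L (∮ ζ in C(c, r), G ζ) :=
    circleIntegral_clm_comp_comm L hG
  rw [hpull]
  set Z := ∮ ζ in C(c, r), G ζ
  have hfd := finiteDimensional_range_comp_right Z.toLinearMap (e : E →L[ℂ] F).toLinearMap
  have h := finiteRankTrace_comp_comm (Z.toLinearMap ∘ₗ (e : E →L[ℂ] F).toLinearMap)
    (e.symm : F →L[ℂ] E).toLinearMap
  refine h.trans (congrArg finiteRankTrace ?_)
  ext u
  simp

lemma continuousOn_ringInverse_mul {A X : Type*} [NormedRing A] [CompleteSpace A]
    [TopologicalSpace X] {f g : X → A} {s : Set X} (hf : ContinuousOn f s) (hg : ContinuousOn g s)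
    (hu : ∀ x ∈ s, IsUnit (f x)) : ContinuousOn (fun x => Ring.inverse (f x) * g x) s := by
  refine ContinuousOn.mul (fun x hx => ?_) hg
  obtain ⟨u, hu⟩ := hu x hx
  have h := NormedRing.inverse_continuousAt u
  rw [hu] at h
  exact h.comp_continuousWithinAt (hf x hx)

lemma contourTrace_eq (V : Potential) (α c : ℂ) {r : ℝ} (hr : 0 ≤ r)
    (hu : ∀ ζ ∈ Metric.sphere c r, IsUnit (torusPencil V α ζ))
    (hfd : FiniteDimensional ℂ (LinearMap.range (∮ ζ in C(c, r), Ring.inverse (torusPencil V α ζ) *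
      ((2 : ℂ) • (resolventPi * (1 - (Real.pi : ℂ) • resolventPi + ζ • resolventPi))) :
        L2 →L[ℂ] L2).toLinearMap)) :
    contourTrace V α c r = 1 / (2 * Real.pi * I) * finiteRankTrace
      (∮ ζ in C(c, r), Ring.inverse (torusPencil V α ζ) *
        ((2 : ℂ) • (resolventPi * (1 - (Real.pi : ℂ) • resolventPi + ζ • resolventPi))) :
          L2 →L[ℂ] L2).toLinearMap := by
  have hcont : ContinuousOn (fun ζ => Ring.inverse (torusPencil V α ζ) *
      ((2 : ℂ) • (resolventPi * (1 - (Real.pi : ℂ) • resolventPi + ζ • resolventPi))))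
      (Metric.sphere c r) := by
    refine continuousOn_ringInverse_mul (continuous_torusPencil V α).continuousOn
      (Continuous.continuousOn ?_) hu
    fun_prop
  rw [contourTrace]
  simp only [inverse_Q_comp_deriv]
  exact congrArg _ (finiteRankTrace_circleIntegral_conj dbarPiSqEquiv (hcont.circleIntegrable hr))

/-- Expanding `(1 + cT)² - W T²` with `c = k₀ - π` exhibits the pencil as the identity plus a
compact operator, so the Fredholm alternative upgrades injectivity to invertibility. -/
lemma isUnit_torusPencil_of_ker_eq_bot (V : Potential) (α k₀ : ℂ)
    (h : LinearMap.ker (Q V α k₀).toLinearMap = ⊥) : IsUnit (torusPencil V α k₀) := by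
  set c : ℂ := k₀ - Real.pi with hc
  set W : L2 →L[ℂ] L2 := α ^ 2 • mulOp V.toFun V.smooth.continuous with hW
  set A : L2 →L[ℂ] L2 := (2 * c) • 1 + c ^ 2 • resolventPi - W * resolventPi with hA
  have hK1 : torusPencil V α k₀ = 1 + A * resolventPi := by
    rw [torusPencil, ← hW, quadPencil, hA, hc]
    ext1 u
    simp only [sub_apply, add_apply, smul_apply, mul_apply_eq_comp, one_apply_eq_self, map_add,
      map_sub, map_smul]
    module
  rw [hK1]
  refine isUnit_one_add_of_injective (K := A * resolventPi)
    (isCompactOperator_resolventPi.clm_comp A) fun x hx => ?_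
  obtain ⟨f, rfl⟩ := dbarPiSqEquiv.surjective x
  have hQ : Q V α k₀ f = 0 := by
    rw [Q_eq_torusPencil_comp, hK1]
    exact hx
  have : f ∈ LinearMap.ker (Q V α k₀).toLinearMap := hQ
  rw [h, Submodule.mem_bot] at this
  rw [this, map_zero]

end Conjugation

/-! ### The rotational symmetry of the potential on the Fourier side -/

section Rotation

open Filter Topology

/-- The rotation `z ↦ ωz` on the torus. -/
def rotTorus : Torus →+ Torus where
  toFun x := ![x 1 - x 0, -x 0]
  map_zero' := by
    funext i
    fin_cases i <;> simp
  map_add' x y := by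
    funext i
    fin_cases i
    · simp only [Pi.add_apply, Fin.zero_eta, Matrix.cons_val_zero]
      abel
    · change -(x 0 + y 0) = -x 0 + -y 0
      abel

lemma continuous_rotTorus : Continuous rotTorus := by
  refine continuous_pi fun i => ?_
  fin_cases i
  · exact (continuous_apply (1 : Fin 2)).sub (continuous_apply (0 : Fin 2))
  · exact (continuous_apply (0 : Fin 2)).neg

lemma surjective_rotTorus : Function.Surjective rotTorus := by
  intro y
  refine ⟨![-y 1, y 0 - y 1], ?_⟩
  funext i
  fin_cases i
  · change (y 0 - y 1) - -y 1 = y 0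
    abel
  · change - -y 1 = y 1
    abel

lemma measurePreserving_rotTorus : MeasurePreserving rotTorus torusMeasure torusMeasure :=
  AddMonoidHom.measurePreserving continuous_rotTorus surjective_rotTorus rfl

lemma integral_rotTorus {g : Torus → ℂ} (hg : AEStronglyMeasurable g torusMeasure) :
    ∫ x, g (rotTorus x) ∂torusMeasure = ∫ x, g x ∂torusMeasure := by
  have h := integral_map measurePreserving_rotTorus.measurable.aemeasurable
    (by rwa [measurePreserving_rotTorus.map_eq]) (f := g)
  rw [measurePreserving_rotTorus.map_eq] at h
  exact h.symm

lemma om_mul_eq (z : ℂ) :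
    om * z = om * ((coordT z - coordS z : ℝ) : ℂ) + ((-coordS z : ℝ) : ℂ) := by
  nth_rewrite 1 [← om_coord z]
  push_cast
  linear_combination (coordS z : ℂ) * om_sq

lemma toTorus_om_mul (z : ℂ) : toTorus (om * z) = rotTorus (toTorus z) := by
  funext i
  rw [om_mul_eq]
  fin_cases i
  · change ((coordS _ : ℝ) : UnitAddCircle) = (coordT z : UnitAddCircle) - (coordS z : UnitAddCircle)
    rw [coordS_om, AddCircle.coe_sub]
  · change ((coordT _ : ℝ) : UnitAddCircle) = -(coordS z : UnitAddCircle)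
    rw [coordT_om, AddCircle.coe_neg]

lemma Potential.rep_rotTorus (V : Potential) (x : Torus) :
    V.toFun (rep (rotTorus x)) = om ^ 2 * V.toFun (rep x) := by
  rw [← conj_om, ← V.rotation]
  refine V.periodic.eq_of_toTorus_eq ?_
  rw [toTorus_rep, toTorus_om_mul, toTorus_rep]

lemma wave_om_mul (n : Fin 2 → ℤ) (z : ℂ) : wave n (om * z) = wave (rotIndex n) z := by
  have e0 : rotIndex n 0 = -n 0 - n 1 := rfl
  have e1 : rotIndex n 1 = n 0 := rfl
  rw [wave, wave, om_mul_eq, coordS_om, coordT_om, e0, e1]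
  congr 1
  push_cast
  ring

lemma mFourier_rotTorus (n : Fin 2 → ℤ) (x : Torus) :
    UnitAddTorus.mFourier n (rotTorus x) = UnitAddTorus.mFourier (rotIndex n) x := by
  have h := wave_om_mul n (rep x)
  rwa [wave_eq_mFourier, wave_eq_mFourier, toTorus_om_mul, toTorus_rep] at h

/-- The Fourier coefficients of the potential. -/
def Potential.coeff (V : Potential) (n : Fin 2 → ℤ) : ℂ :=
  ∫ x, V.toFun (rep x) * UnitAddTorus.mFourier (-n) x ∂torusMeasure

/-- The substitution `z ↦ ωz` produces `ω²` from the potential and rotates the index of the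
exponential; `ω³ = 1` moves the factor to the other side. -/
lemma Potential.coeff_rotIndex (V : Potential) (n : Fin 2 → ℤ) :
    V.coeff (rotIndex n) = om * V.coeff n := by
  have hm : AEStronglyMeasurable (fun x => V.toFun (rep x) * UnitAddTorus.mFourier (-n) x)
      torusMeasure :=
    (memLp_comp_rep V.smooth.continuous).aestronglyMeasurable.mul
      (UnitAddTorus.mFourier (-n)).continuous.aestronglyMeasurable
  have h := integral_rotTorus hm
  simp only [V.rep_rotTorus, mFourier_rotTorus, mul_assoc, map_neg] at h
  rw [integral_const_mul] at h
  rw [Potential.coeff, Potential.coeff, ← h]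
  linear_combination (-∫ x, V.toFun (rep x) * UnitAddTorus.mFourier (-rotIndex n) x ∂torusMeasure) *
    om_cube

lemma coeFn_mulOp {g : ℂ → ℂ} (hg : Continuous g) (u : L2) :
    mulOp g hg u =ᵐ[torusMeasure] fun x => g (rep x) * u x := by
  have h := (ContinuousLinearMap.mul ℂ ℂ).coeFn_holder (r := 2) (memLp_comp_rep hg).toLp u
  have h' : mulOp g hg u = (ContinuousLinearMap.mul ℂ ℂ).holder 2 (memLp_comp_rep hg).toLp u := rfl
  rw [h']
  filter_upwards [h, (memLp_comp_rep hg).coeFn_toLp] with x hx hx'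
  rw [hx, hx']
  rfl

lemma repr_mulOp_fourierBasis (V : Potential) (m n : Fin 2 → ℤ) :
    fourierBasis.repr (mulOp V.toFun V.smooth.continuous (fourierBasis n)) m = V.coeff (m - n) := by
  rw [fourierBasis_repr, Potential.coeff]
  refine integral_congr_ae ?_
  filter_upwards [coeFn_mulOp V.smooth.continuous (fourierBasis n), coeFn_fourierBasis n]
    with x hx hx'
  rw [hx, hx', neg_sub, sub_eq_add_neg, UnitAddTorus.mFourier_add]
  ring

/-- Multiplication by the potential, up to the factor `ω`, commutes with the rotation about any
point of the dual lattice. -/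
lemma mulOp_comp_permOp (V : Potential) (s : Fin 2 → ℤ) {R : L2 →L[ℂ] L2}
    (hR : ∀ x n, fourierBasis.repr (R x) (rotIndex n + s) = fourierBasis.repr x n) (u : L2) :
    mulOp V.toFun V.smooth.continuous (R u) = om • R (mulOp V.toFun V.smooth.continuous u) := by
  set W := mulOp V.toFun V.smooth.continuous
  have hsurj : ∀ m, ∃ n, rotIndex n + s = m := fun m =>
    ⟨rotIndex.symm (m - s), by rw [AddEquiv.apply_symm_apply, sub_add_cancel]⟩
  have hRb : ∀ n, R (fourierBasis n) = fourierBasis (rotIndex n + s) := fun n => by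
    refine hilbertBasis_ext fourierBasis fun m => ?_
    obtain ⟨m, rfl⟩ := hsurj m
    rw [hR, repr_self_apply, repr_self_apply]
    simp
  have heq : W ∘L R = om • (R ∘L W) := by
    refine ContinuousLinearMap.ext_on (s := Set.range fourierBasis) ?_ ?_
    · rw [← Submodule.dense_iff_topologicalClosure_eq_top.symm.eq]
      exact fourierBasis.dense_span
    · rintro _ ⟨n, rfl⟩
      refine hilbertBasis_ext fourierBasis fun m => ?_
      obtain ⟨m, rfl⟩ := hsurj m
      change fourierBasis.repr (W (R (fourierBasis n))) (rotIndex m + s) =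
        fourierBasis.repr (om • R (W (fourierBasis n))) (rotIndex m + s)
      -- The matrix entries of `W` depend only on the difference of the indices, so the shift `s`
      -- cancels and the symmetry of the coefficients applies.
      rw [hRb, repr_mulOp_fourierBasis, map_smul, lp.coeFn_smul, Pi.smul_apply, hR,
        repr_mulOp_fourierBasis, add_sub_add_right_eq_sub, ← map_sub, V.coeff_rotIndex, smul_eq_mul]
  exact DFunLike.congr_fun heq u

/-- At a point of the dual lattice, the pencil has a Jordan chain of length two, or two independent
null vectors. -/
lemma exists_jordan_chain_torusPencil (V : Potential) (α : ℂ) {k : ℂ} (hk : k ∈ dualLattice) :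
    ∃ f₀ f₁ : L2, f₀ ≠ 0 ∧ torusPencil V α k f₀ = 0 ∧
      (torusPencil V α k f₁ =
          -(2 : ℂ) • (1 - (Real.pi : ℂ) • resolventPi + k • resolventPi) (resolventPi f₀) ∨
        (torusPencil V α k f₁ = 0 ∧ ∀ c : ℂ, c • f₀ ≠ f₁)) := by
  obtain ⟨m, rfl⟩ := exists_freq_eq hk
  have hneg : freq (-m) = -freq m := by
    have := freq_add (-m) m
    rw [neg_add_cancel] at this
    have h0 : freq 0 = 0 := by simpa using freq_add 0 0
    linear_combination h0 - this
  -- This shift turns `rotIndex` into the rotation about `-m`, the index at which `freq n + freq m`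
  -- vanishes.
  set s := rotIndex m - m with hs
  set σ : Equiv.Perm (Fin 2 → ℤ) := rotIndex.toEquiv.trans (Equiv.addRight s) with hσ
  have hσn : ∀ n, σ n = rotIndex n + s := fun n => rfl
  obtain ⟨R, hR⟩ := exists_permOp fourierBasis σ
  refine exists_jordan_chain fourierBasis σ hR (q := fun n => freq n + freq m) (n₀ := -m) om_cube
    om_ne_one ?_ ?_ ?_ (tendsto_norm_freq_add _) ?_ ?_ ?_
  · intro n
    have e : rotIndex n + s + m = rotIndex (n + m) := by
      rw [map_add, hs]
      abel
    rw [hσn, ← freq_add, e, freq_rotIndex, freq_add]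
  · intro n
    rw [← freq_injective.eq_iff, hneg, add_eq_zero_iff_eq_neg]
  · rw [hσn, map_neg, hs]
    abel
  · intro n
    have := freq_add_pi_ne_zero n
    convert this using 1
    ring
  · intro u
    have h := mulOp_comp_permOp V s hR u
    rw [smul_apply, smul_apply, h, map_smul, smul_comm]
  · intro u n
    rw [repr_resolventPi]
    congr 2
    ring

end Rotation

/-! ### Independence of the disc and the lower bound -/

section Multiplicity

open Filter Topology

lemma commute_shift_resolventPi :
    Commute (1 - (Real.pi : ℂ) • resolventPi) resolventPi :=
  (Commute.one_left _).sub_left ((Commute.refl resolventPi).smul_left _)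

/-- If `Q(α, k₀)` is injective for some `k₀`, then every `k` in the dual lattice has an isolating
disc, and the contour integral has the same value, an integer `≥ 2`, for all of them. -/
theorem exists_contourTrace_eq (V : Potential) (α : ℂ) {k : ℂ} (hk : k ∈ dualLattice)
    (h : ∃ k₀ : ℂ, LinearMap.ker (Q V α k₀).toLinearMap = ⊥) :
    ∃ m : ℕ, 2 ≤ m ∧ (∃ (c : ℂ) (r : ℝ), IsIsolatingDisc V α k c r) ∧
      ∀ (c : ℂ) (r : ℝ), IsIsolatingDisc V α k c r → contourTrace V α c r = m := by
  obtain ⟨k₀, hk₀⟩ := h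
  obtain ⟨f₀, f₁, hf₀, hker, hf₁⟩ := exists_jordan_chain_torusPencil V α hk
  obtain ⟨m, hm, hev, htr⟩ := quadPencil_trace commute_shift_resolventPi
    isCompactOperator_resolventPi (isUnit_torusPencil_of_ker_eq_bot V α k₀ hk₀) hf₀ hker hf₁
  refine ⟨m, hm, ?_, fun c r hD => ?_⟩
  · rw [eventually_nhdsWithin_iff, Metric.eventually_nhds_iff] at hev
    obtain ⟨ε, hε, hball⟩ := hev
    refine ⟨k, ε / 2, Metric.mem_ball_self (half_pos hε), fun ζ hζ hne => ?_⟩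
    rw [isInvertible_Q_iff]
    exact hball ((Metric.mem_closedBall.mp hζ).trans_lt (half_lt_self hε)) hne
  · have hu : ∀ ζ ∈ Metric.closedBall c r, ζ ≠ k → IsUnit (torusPencil V α ζ) :=
      fun ζ hζ hne => (isInvertible_Q_iff V α ζ).mp (hD.2 ζ hζ hne)
    obtain ⟨hfd, hval⟩ := htr c r hD.1 hu
    have hr : 0 < r := dist_nonneg.trans_lt (Metric.mem_ball.mp hD.1)
    rw [contourTrace_eq V α c hr.le (fun ζ hζ => hu ζ (Metric.sphere_subset_closedBall hζ) ?_) hfd]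
    · change 1 / (2 * Real.pi * I) * finiteRankTrace (∮ ζ in C(c, r),
        Ring.inverse (quadPencil _ _ _ ζ) * _ : L2 →L[ℂ] L2).toLinearMap = _
      rw [hval]
      have hpi : (Real.pi : ℂ) ≠ 0 := ofReal_ne_zero.mpr Real.pi_ne_zero
      field_simp [I_ne_zero]
    · rintro rfl
      exact (Metric.mem_ball.mp hD.1).ne (Metric.mem_sphere.mp hζ)

end Multiplicity
end
end ScalarModel

theorem propositionp (V : ScalarModel.Potential) (α k : ℂ) (hk : k ∈ ScalarModel.dualLattice) :
    ((2 : ℂ) : WithTop ℂ) ≤ ScalarModel.mult V α k ∧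
      ((∃ k₀ : ℂ, LinearMap.ker (ScalarModel.Q V α k₀).toLinearMap = ⊥) →
        (∃ (c : ℂ) (r : ℝ), ScalarModel.IsIsolatingDisc V α k c r) ∧
        ∀ (c : ℂ) (r : ℝ), ScalarModel.IsIsolatingDisc V α k c r →
          ScalarModel.mult V α k = (ScalarModel.contourTrace V α c r : WithTop ℂ)) := by
  by_cases h : ∃ k₀ : ℂ, LinearMap.ker (ScalarModel.Q V α k₀).toLinearMap = ⊥
  · obtain ⟨m, hm, ⟨c₀, r₀, hD₀⟩, htr⟩ := ScalarModel.exists_contourTrace_eq V α hk h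
    have hex : ∃ D : ℂ × ℝ, ScalarModel.IsIsolatingDisc V α k D.1 D.2 := ⟨(c₀, r₀), hD₀⟩
    -- The definition uses an arbitrarily chosen isolating disc; since all such discs give the same
    -- `m`, the choice does not matter.
    have hmult : ScalarModel.mult V α k = ((m : ℂ) : WithTop ℂ) := by
      rw [ScalarModel.mult, if_pos h, dif_pos hex, htr _ _ hex.choose_spec]
    refine ⟨?_, fun _ => ⟨⟨c₀, r₀, hD₀⟩, fun c r hD => ?_⟩⟩
    · rw [hmult, WithTop.coe_le_coe]
      exact_mod_cast hm
    · rw [hmult, htr c r hD]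
  · refine ⟨?_, fun h' => absurd h' h⟩
    rw [ScalarModel.mult, if_neg h]
    exact le_top
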